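/- For graphs $G_1,G_2$ let $G_1+G_2$ denote their complete join, $mG$ the disjoint union of $m$ copies of $G$, and $\Delta(G)$ the maximum degree of $G$. For a fixed graph $G$ and an integer $n\ge |V(G)|$, let $\mathrm{Lr}(n,G)$ be the smallest positive integer $k$ such that every edge coloring of the complete graph $K_n$ in which at least $k$ colors occur contains a copy of $G$ in which each color class is a matching (i.e. a properly edge-colored copy of $G$). More generally, for an integer $t\ge 1$ let $\mathrm{Lr}(n,t,G)$ be the smallest positive integer $k$ such that every edge coloring of $K_n$ in which at least $k$ colors occur contains a copy of $G$ in which each color class is a graph of maximum degree at most $t$. Let $B_t=K_2+tK_1$ (the book with $t$ pages), $M_{s,t}=sK_2+tK_1$, and $B(H,r)=H+rK_1$. **Theorem (Generalized Book Graphs).** In the following, $n\to\infty$ while all the other parameters are fixed; the constants implied by $\Theta$ may depend on those parameters. (i) If $t=1$ or $t=2$, then $\mathrm{Lr}(n,B_t)=\Theta(n)$. (ii) If $t\ge 3$, then $\mathrm{Lr}(n,B_t)=\Theta(n^{3/2})$. (iii) For every integer $s\ge 1$ there is $t_0=t_0(s)$ such that $\mathrm{Lr}(n,M_{s,t})=\Theta\bigl(n^{2-1/(2s)}\bigr)$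 for every $t\ge t_0$. (iv) For all integers $s\ge 1$ and $t\ge 1$ there is $r_0=r_0(s,t)$ such that, for every graph $H$ with $|V(H)|=s$ and $\Delta(H)\le t$ and every $r\ge r_0$, $\mathrm{Lr}(n,t,B(H,r))=\Theta\bigl(n^{2-1/s}\bigr)$. -/

import Mathlib

open Filter Asymptotics

universe u v

/-- A family of graphs: a property of graphs, on any vertex type. A member stands for its edge set,
so that isolated vertices play no role in the families below. -/
def GraphFamily : Type (u + 1) := (V : Type u) → SimpleGraph V → Prop

/-- The family `{m K₂ : m ≥ 1}` of matchings: there is at least one edge, and no vertex lies on two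
different edges. -/
def matchings : GraphFamily.{u} := fun _ D =>
  D ≠ ⊥ ∧ ∀ x y z, D.Adj x y → D.Adj x z → y = z

/-- The family of graphs of maximum degree at most `t`. -/
def degreeAtMost (t : ℕ) : GraphFamily.{u} := fun _ D =>
  ∀ x, (D.neighborSet x).encard ≤ t

/-- The copy `φ` of `G` in the edge-coloured complete graph on `Fin n` is `F`-coloured: for each
colour `i` that occurs on the copy, the edges of the copy of colour `i` form a member of `F`.
The colour class is described as a graph on the vertices of `G`. -/
def IsFamilyColored (F : GraphFamily.{u}) {V : Type u} {G : SimpleGraph V} {n : ℕ}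
    (c : SimpleGraph.TopEdgeLabeling (Fin n) ℕ)
    (φ : SimpleGraph.Copy G (⊤ : SimpleGraph (Fin n))) : Prop :=
  ∀ i ∈ Set.range (SimpleGraph.EdgeLabeling.pullback c φ.toHom),
    F V ((SimpleGraph.EdgeLabeling.pullback c φ.toHom).labelGraph i)

/-- `f(n, G | F)`: the smallest positive integer `k` such that every edge colouring of `K_n` in
which at least `k` colours occur has an `F`-coloured copy of `G`. Such integers always exist,
since every `k` larger than the number of edges of `K_n` is one. -/
noncomputable def familyNumber (n : ℕ) {V : Type u} (G : SimpleGraph V)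
    (F : GraphFamily.{u}) : ℕ :=
  sInf {k : ℕ | 1 ≤ k ∧ ∀ c : SimpleGraph.TopEdgeLabeling (Fin n) ℕ,
    k ≤ (Set.range c).ncard →
      ∃ φ : SimpleGraph.Copy G (⊤ : SimpleGraph (Fin n)), IsFamilyColored F c φ}

/-- `Lr(n, G)`, the local anti-Ramsey number. -/
noncomputable def Lr (n : ℕ) {V : Type u} (G : SimpleGraph V) : ℕ :=
  familyNumber n G matchings

/-- `Lr(n, t, G)`, the `t`-defective local anti-Ramsey number. -/
noncomputable def LrDefective (n t : ℕ) {V : Type u} (G : SimpleGraph V) : ℕ :=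
  familyNumber n G (degreeAtMost t)

/-- The complete join `G + H` of two graphs. -/
def graphJoin {V : Type u} {W : Type v} (G : SimpleGraph V) (H : SimpleGraph W) :
    SimpleGraph (V ⊕ W) :=
  SimpleGraph.sum G H ⊔ completeBipartiteGraph V W

/-- `B(H, r) = H + r K₁`, the complete join of `H` and an independent set of size `r`. -/
def bookOver {V : Type u} (H : SimpleGraph V) (r : ℕ) : SimpleGraph (V ⊕ Fin r) :=
  graphJoin H (⊥ : SimpleGraph (Fin r))

/-- `s K₂`, the disjoint union of `s` edges. -/
def disjointEdges (s : ℕ) : SimpleGraph (Fin s × Fin 2) where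
  Adj x y := x.1 = y.1 ∧ x.2 ≠ y.2
  symm := ⟨fun _ _ h => ⟨h.1.symm, h.2.symm⟩⟩
  loopless := ⟨fun _ h => h.2 rfl⟩

/-- The book `B_t = K₂ + t K₁` with `t` pages. -/
def book (t : ℕ) : SimpleGraph (Fin 2 ⊕ Fin t) :=
  bookOver (⊤ : SimpleGraph (Fin 2)) t

/-- `M_{s,t} = s K₂ + t K₁`. -/
def matchingBook (s t : ℕ) : SimpleGraph ((Fin s × Fin 2) ⊕ Fin t) :=
  bookOver (disjointEdges s) t

/-! Upper bounds: keep one edge of each color. If the resulting graph has more than `C * n ^ (2 - 1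
/ s)` edges, Kővári–Sós–Turán gives `s` vertices with many common neighbors. The edges to these
neighbors have distinct colors, and at most `s * s` of the neighbors use a color that also occurs
inside the `s`-set. After discarding those, only the color classes inside `H` can have more than one
edge, and these are harmless when `H` is a matching or has maximum degree at most `t`
(`exists_isFamilyColored_bookOver`).

Lower bounds: give the edges of a graph `Γ` distinct colors and all other edges color zero. In an
admissible copy each spine vertex sends few zero edges to the pages, so almost all pages are common
neighbors of the spine in `Γ`. Norm graphs have about `n ^ (2 - 1 / s)` edges and bounded common
neighborhoods (`exists_norm_graph`). The bound amounts to finiteness, uniform over all fields, for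
systems `∏ j, (y j - a i j) = b i`. It is obtained from integrality of the generic unknowns, which
is tested on valuation rings.

Books need sharper arguments. For three or more pages, the point-line incidence graph has neither
triangles nor 4-cycles. For one or two pages, coloring each edge by its smaller end gives the lower
bound, and a vertex with at most two private colors can be deleted repeatedly for the upper bound
(`exists_isProperBook`). -/

/-! ### Valuations and systems of norm type -/

/-- If `x j` lay outside `V`, its factor would have value above 1 in every product, so each equation
`i` needs a compensating factor of value below 1, at some `k` with `x k` in `V`. The unit
differences make `i ↦ k` injective. There are as many equations as unknowns, so it is onto and hits
`j`. -/
theorem ValuationSubring.mem_of_prod_sub_mem {K ι : Type*} [Field K] [Fintype ι]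
    (V : ValuationSubring K) (a : ι → ι → K) (x : ι → K) (ha : ∀ i j, a i j ∈ V)
    (hunit : ∀ i i' j, i ≠ i' → V.valuation (a i j - a i' j) = 1)
    (hf : ∀ i, ∏ j, (x j - a i j) ∈ V) (j : ι) : x j ∈ V := by
  by_contra hj
  have key : ∀ i, ∃ k, x k ∈ V ∧ V.valuation (x k - a i k) < 1 := by
    intro i
    by_contra! hcon
    have hge : ∀ k, 1 ≤ V.valuation (x k - a i k) := by
      intro k
      by_cases hk : x k ∈ V
      · exact hcon k hk
      · by_contra! hlt
        apply hk
        have := V.add_mem _ _ (V.valuation_le_one_iff _ |>.1 hlt.le) (ha i k)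
        simpa using this
    have hgt : 1 < V.valuation (x j - a i j) := by
      by_contra! hle
      apply hj
      have := V.add_mem _ _ (V.valuation_le_one_iff _ |>.1 hle) (ha i j)
      simpa using this
    have h1 := (V.valuation_le_one_iff _).2 (hf i)
    rw [map_prod] at h1
    classical
    rw [← Finset.mul_prod_erase _ _ (Finset.mem_univ j)] at h1
    have h2 : 1 ≤ ∏ k ∈ Finset.univ.erase j, V.valuation (x k - a i k) :=
      Finset.one_le_prod' fun k _ => hge k
    have h3 : V.valuation (x j - a i j) ≤ 
      V.valuation (x j - a i j) * ∏ k ∈ Finset.univ.erase j, V.valuation (x k - a i k) :=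
      le_mul_of_one_le_right' h2
    exact absurd (hgt.trans_le h3) (not_lt.2 h1)
  choose τ hτ using key
  have hinj : Function.Injective τ := by
    intro i i' h
    by_contra hne
    have h1 := (hτ i).2
    have h2 := (hτ i').2
    rw [← h] at h2
    have h3 := V.valuation.map_sub_lt h2 h1
    rw [sub_sub_sub_cancel_left, hunit _ _ _ hne] at h3
    exact lt_irrefl _ h3
  obtain ⟨i, hi⟩ := (Finite.injective_iff_surjective.1 hinj) j
  exact hj (hi ▸ (hτ i).1)

namespace NormSystem

variable (ι : Type) [Fintype ι] [DecidableEq ι]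

/-- The product of all differences `a i j - a i' j` with `i ≠ i'`. -/
def disc {ι R : Type*} [Fintype ι] [DecidableEq ι] [CommRing R] (a : ι → ι → R) : R :=
  ∏ q : ι × ι × ι, if q.1 = q.2.1 then 1 else a q.1 q.2.2 - a q.2.1 q.2.2

theorem map_disc {ι R S : Type*} [Fintype ι] [DecidableEq ι] [CommRing R] [CommRing S]
    (f : R →+* S) (a : ι → ι → R) : f (disc a) = disc fun i j => f (a i j) := by
  simp [disc, map_prod, apply_ite f]

theorem disc_ne_zero {ι R : Type*} [Fintype ι] [DecidableEq ι] [CommRing R] [IsDomain R]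
    {a : ι → ι → R} (h : ∀ i i' j, i ≠ i' → a i j ≠ a i' j) : disc a ≠ 0 := by
  refine Finset.prod_ne_zero_iff.2 fun q _ => ?_
  split_ifs with hq
  · exact one_ne_zero
  · exact sub_ne_zero.2 (h _ _ _ hq)

/-- All factors of `disc a` have value at most 1 and their product is a unit of `V`, so each factor
has value exactly 1. -/
theorem valuation_sub_eq_one {ι K : Type*} [Fintype ι] [DecidableEq ι] [Field K]
    (V : ValuationSubring K) (a : ι → ι → K) (ha : ∀ i j, a i j ∈ V) {d : K} (hd : d ∈ V)
    (had : disc a * d = 1) {i i' : ι} (h : i ≠ i') (j : ι) :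
    V.valuation (a i j - a i' j) = 1 := by
  have hle : ∀ q ∈ Finset.univ, V.valuation ((fun q : ι × ι × ι => if q.1 = q.2.1 then 1
      else a q.1 q.2.2 - a q.2.1 q.2.2) q) ≤ 1 := by
    intro q _
    dsimp only
    split_ifs
    · simp
    · exact (V.valuation_le_one_iff _).2 (V.toSubring.sub_mem (ha _ _) (ha _ _))
  have hprod : V.valuation (disc a) = 1 := by
    refine le_antisymm ?_ ?_
    · unfold disc
      rw [map_prod]
      exact Finset.prod_le_one' hle
    · have h1 := congrArg V.valuation had
      rw [map_mul, map_one] at h1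
      rw [← h1]
      exact mul_le_of_le_one_right' ((V.valuation_le_one_iff _).2 hd)
  unfold disc at hprod
  rw [map_prod] at hprod
  have := (Finset.prod_eq_one_iff_of_le_one' hle).1 hprod (i, i', j) (Finset.mem_univ _)
  dsimp only at this
  rwa [if_neg h] at this

/-- Polynomials in the coefficients `a i j` and the unknowns `x j`. -/
abbrev Poly : Type := MvPolynomial ((ι × ι) ⊕ ι) ℤ

/-- The generic coefficients. -/
noncomputable def coeff (i j : ι) : Poly ι := MvPolynomial.X (Sum.inl (i, j))

/-- The generic unknowns. -/
noncomputable def unknown (j : ι) : Poly ι := MvPolynomial.X (Sum.inr j)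

theorem disc_coeff_ne_zero : disc (coeff ι) ≠ 0 := by
  refine disc_ne_zero fun i i' j h => ?_
  simpa [coeff, MvPolynomial.X_injective.eq_iff] using h

/-- The coordinate ring of generic systems. -/
abbrev Ring : Type := Localization.Away (disc (coeff ι))

instance : IsDomain (Ring ι) :=
  IsLocalization.isDomain_localization
    (powers_le_nonZeroDivisors_of_noZeroDivisors (disc_coeff_ne_zero ι))

/-- The polynomial ring in the coefficients, the values of the products, and the inverse of the
product of the differences. -/
abbrev Base : Type := MvPolynomial ((ι × ι) ⊕ ι ⊕ Unit) ℤ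

/-- The specialization of `Base ι`. -/
noncomputable def baseHom {R : Type*} [CommRing R] (a : ι → ι → R) (b : ι → R) (d : R) :
    Base ι →+* R :=
  MvPolynomial.eval₂Hom (Int.castRingHom R)
    (Sum.elim (fun q => a q.1 q.2) (Sum.elim b fun _ => d))

/-- The generic unknown lies in every valuation ring containing the image of `Base ι`, hence is
integral over that image. The equation is lifted to the polynomial ring `Base ι` so that it can be
specialized to every field. -/
theorem exists_monic (j : ι) : ∃ P : Polynomial (Base ι), P.Monic ∧
    P.eval₂ (baseHom ι (fun i j => algebraMap (Poly ι) (Ring ι) (coeff ι i j))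
      (fun i => algebraMap (Poly ι) (Ring ι) (∏ j, (unknown ι j - coeff ι i j)))
      (IsLocalization.Away.invSelf (disc (coeff ι)))) (algebraMap _ _ (unknown ι j)) = 0 := by
  set ψ := (baseHom ι (fun i j => algebraMap (Poly ι) (Ring ι) (coeff ι i j))
      (fun i => algebraMap (Poly ι) (Ring ι) (∏ j, (unknown ι j - coeff ι i j)))
      (IsLocalization.Away.invSelf (disc (coeff ι)))) with hψ
  let K := FractionRing (Ring ι)
  let ρ : Ring ι →+* K := algebraMap _ _
  have hρ : Function.Injective ρ := IsFractionRing.injective (Ring ι) K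
  let Ψ : Base ι →+* K := ρ.comp ψ
  let π : Poly ι →+* K := ρ.comp (algebraMap _ _)
  have hmem : π (unknown ι j) ∈ (⨅ V : {V : ValuationSubring K // (Ψ.range : Set K) ⊆ V.toSubring},
      V.1.toSubring) := by
    rw [Subring.mem_iInf]
    rintro ⟨V, hV⟩
    have ha : ∀ i j, π (coeff ι i j) ∈ V := fun i j =>
      hV ⟨MvPolynomial.X (Sum.inl (i, j)), by simp [Ψ, hψ, baseHom, π]⟩
    refine V.mem_of_prod_sub_mem (fun i j => π (coeff ι i j)) (fun j => π (unknown ι j)) ha ?_ ?_ j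
    · intro i i' j h
      refine valuation_sub_eq_one V _ ha
        (d := ρ (IsLocalization.Away.invSelf (disc (coeff ι)))) ?_ ?_ h j
      · exact hV ⟨MvPolynomial.X (Sum.inr (Sum.inr ())), by simp [Ψ, hψ, baseHom]⟩
      · have hmul : π (disc (coeff ι)) * ρ (IsLocalization.Away.invSelf (disc (coeff ι))) = 1 := by
          rw [RingHom.comp_apply, ← map_mul, IsLocalization.Away.mul_invSelf, map_one]
        rwa [map_disc] at hmul
    · intro i
      have : π (∏ j, (unknown ι j - coeff ι i j)) ∈ V :=
        hV ⟨MvPolynomial.X (Sum.inr (Sum.inl i)), by simp [Ψ, hψ, baseHom, π]⟩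
      simpa [map_prod] using this
  -- The intersection of the valuation rings containing a subring is its integral closure.
  rw [iInf_valuationSubring_superset, Subring.closure_eq] at hmem
  obtain ⟨p, hp, hp0⟩ : IsIntegral Ψ.range (π (unknown ι j)) := hmem
  obtain ⟨P, hP, -, hPm⟩ := Polynomial.lifts_and_natDegree_eq_and_monic
    ((Polynomial.mem_lifts p).2 (Polynomial.map_surjective _ Ψ.rangeRestrict_surjective p) : p ∈ Polynomial.lifts Ψ.rangeRestrict) hp
  refine ⟨P, hPm, hρ ?_⟩
  rw [map_zero, Polynomial.hom_eval₂]
  rw [← hP, Polynomial.eval₂_map] at hp0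
  exact hp0

/-- The number of possible values of a coordinate of a solution of a system of equations
`∏ j, (y j - a i j) = b i`, one for each `i`, is bounded in terms of the number of unknowns if
different equations have different coefficients at each unknown. -/
theorem exists_card_le (j₀ : ι) : ∃ D : ℕ, ∀ (F : Type) [Field F] (a : ι → ι → F) (b : ι → F),
    (∀ i i' j, i ≠ i' → a i j ≠ a i' j) → ∀ S : Finset F,
      (∀ x ∈ S, ∃ y : ι → F, y j₀ = x ∧ ∀ i, ∏ j, (y j - a i j) = b i) → S.card ≤ D := by
  obtain ⟨P, hPm, hP⟩ := exists_monic ι j₀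
  refine ⟨P.natDegree, fun F _ a b hab S hS => ?_⟩
  -- The specialization involves `a` and `b` but no solution `y`, so one polynomial has the chosen
  -- coordinate of every solution as a root.
  let θ := baseHom ι a b (disc a)⁻¹
  have hθ0 : P.map θ ≠ 0 := (hPm.map θ).ne_zero
  have hsub : S.val ⊆ (P.map θ).roots := by
    intro x hx
    obtain ⟨y, rfl, hy⟩ := hS x hx
    rw [Polynomial.mem_roots hθ0, Polynomial.IsRoot.def, Polynomial.eval_map]
    let g : Poly ι →+* F := MvPolynomial.eval₂Hom (Int.castRingHom F)
      (Sum.elim (fun q => a q.1 q.2) y)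
    have hga : ∀ i j, g (coeff ι i j) = a i j := fun i j => by
      simp only [g, coeff, MvPolynomial.eval₂Hom_X', Sum.elim_inl]
    have hgx : ∀ j, g (unknown ι j) = y j := fun j => by
      simp only [g, unknown, MvPolynomial.eval₂Hom_X', Sum.elim_inr]
    have hgd : g (disc (coeff ι)) = disc a := by rw [map_disc]; simp only [hga]
    have hgu : IsUnit (g (disc (coeff ι))) := by
      rw [hgd]; exact (disc_ne_zero hab).isUnit
    let g' : Ring ι →+* F := IsLocalization.Away.lift (disc (coeff ι)) hgu
    have hg' : ∀ z, g' (algebraMap _ _ z) = g z := IsLocalization.Away.lift_eq _ hgu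
    have h := congrArg g' hP
    rw [map_zero, Polynomial.hom_eval₂, hg', hgx] at h
    have hθ : θ = g'.comp (baseHom ι (fun i j => algebraMap (Poly ι) (Ring ι) (coeff ι i j))
        (fun i => algebraMap (Poly ι) (Ring ι) (∏ j, (unknown ι j - coeff ι i j)))
        (IsLocalization.Away.invSelf (disc (coeff ι)))) := by
      refine MvPolynomial.ringHom_ext (fun r => ?_) ?_
      · rw [eq_intCast (MvPolynomial.C : ℤ →+* Base ι) r, map_intCast, map_intCast]
      rintro (⟨i, j⟩ | i | _)
      · simp [θ, baseHom, hg', hga]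
      · simp only [θ, baseHom, RingHom.comp_apply, MvPolynomial.eval₂Hom_X', Sum.elim_inr, Sum.elim_inl]
        rw [hg', map_prod]
        simp [hga, hgx, hy]
      · simp only [θ, baseHom, RingHom.comp_apply, MvPolynomial.eval₂Hom_X', Sum.elim_inr]
        refine inv_eq_of_mul_eq_one_right ?_
        rw [← hgd, ← hg', ← map_mul, IsLocalization.Away.mul_invSelf, map_one]
    rwa [hθ]
  calc S.card ≤ (P.map θ).roots.card := Multiset.card_le_card ((Multiset.le_iff_subset S.nodup).2 hsub)
    _ ≤ (P.map θ).natDegree := Polynomial.card_roots' _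
    _ = P.natDegree := hPm.natDegree_map θ

end NormSystem

/-! ### Common neighborhoods and the Kővári–Sós–Turán bound -/

namespace SimpleGraph

/-- Any `s` vertices have at most `D` common neighbors. -/
def CommonNeighborsLE {V : Type*} (Γ : SimpleGraph V) (s D : ℕ) : Prop :=
  ∀ A : Finset V, A.card = s → {x | ∀ a ∈ A, Γ.Adj a x}.ncard ≤ D

theorem card_filter_adj {V : Type*} [Fintype V] (Γ : SimpleGraph V) [DecidableRel Γ.Adj] :
    (Finset.univ.filter fun q : V × V => Γ.Adj q.1 q.2).card = 2 * Γ.edgeSet.ncard := by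
  classical
  rw [← Γ.coe_edgeFinset, Set.ncard_coe_finset, ← Γ.sum_degrees_eq_twice_card_edges,
    ← Finset.univ_product_univ, Finset.card_filter, Finset.sum_product]
  refine Finset.sum_congr rfl fun v _ => ?_
  rw [← Finset.card_filter, ← Γ.card_neighborFinset_eq_degree]
  congr 1
  ext w
  simp

theorem ncard_edgeSet_map {V W : Type*} (Γ : SimpleGraph V) (e : V ↪ W) :
    (Γ.map e).edgeSet.ncard = Γ.edgeSet.ncard := by
  rw [edgeSet_map]
  exact Set.ncard_image_of_injective _ (Function.Embedding.injective _)

/-- Positive `s` is needed: for the empty set the condition bounds the number of vertices, which an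
embedding can increase. -/
theorem CommonNeighborsLE.map {V W : Type*} [Finite V] {Γ : SimpleGraph V} {s D : ℕ} (hs : 1 ≤ s)
    (h : Γ.CommonNeighborsLE s D) (e : V ↪ W) : (Γ.map e).CommonNeighborsLE s D := by
  classical
  intro A hA
  by_cases hne : ∃ x, ∀ a ∈ A, (Γ.map e).Adj a x
  · obtain ⟨x, hx⟩ := hne
    have hsub : ∀ a ∈ A, a ∈ Set.range e := by
      intro a ha
      obtain ⟨-, u, v, -, rfl, -⟩ := hx a ha
      exact ⟨u, rfl⟩
    obtain ⟨B, rfl⟩ : ∃ B : Finset V, A = B.map e := by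
      refine ⟨A.preimage e e.injective.injOn, ?_⟩
      ext a
      simp only [Finset.mem_map, Finset.mem_preimage]
      constructor
      · intro ha
        obtain ⟨u, rfl⟩ := hsub a ha
        exact ⟨u, ha, rfl⟩
      · rintro ⟨u, hu, rfl⟩
        exact hu
    rw [Finset.card_map] at hA
    refine le_trans ?_ (h B hA)
    obtain ⟨b, hb⟩ : B.Nonempty := Finset.card_pos.1 (by omega)
    have : {x | ∀ a ∈ B.map e, (Γ.map e).Adj a x} ⊆ e '' {x | ∀ a ∈ B, Γ.Adj a x} := by
      intro y hy
      obtain ⟨-, u, v, -, -, rfl⟩ := hy (e b) (Finset.mem_map_of_mem _ hb)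
      refine ⟨v, fun a ha => ?_, rfl⟩
      exact (map_adj_apply).1 (hy (e a) (Finset.mem_map_of_mem _ ha))
    refine (Set.ncard_le_ncard this (Set.toFinite _)).trans ?_
    exact Set.ncard_image_le (Set.toFinite _)
  · have : {x | ∀ a ∈ A, (Γ.map e).Adj a x} = ∅ := by
      ext x
      simp only [Set.mem_ofPred_eq, Set.mem_empty_iff_false, iff_false]
      exact fun hx => hne ⟨x, hx⟩
    rw [this]
    simp

/-- An integral substitute for the convexity of binomial coefficients; the summand 1 covers `d < s`.
-/
theorem _root_.Nat.pow_le_mul_choose_add_one (s d : ℕ) :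
    d ^ s ≤ s ^ s * (s.factorial * d.choose s + 1) := by
  by_cases h : s ≤ d
  · rcases Nat.eq_zero_or_pos s with rfl | hs
    · simp
    have h1 : (d + 1 - s) ^ s ≤ s.factorial * d.choose s := by
      rw [← Nat.descFactorial_eq_factorial_mul_choose]
      exact Nat.pow_sub_le_descFactorial d s
    have h2 : d ≤ s * (d + 1 - s) := by
      obtain ⟨k, rfl⟩ := Nat.exists_eq_add_of_le h
      have : s + k + 1 - s = k + 1 := by omega
      rw [this]
      nlinarith
    calc d ^ s ≤ (s * (d + 1 - s)) ^ s := Nat.pow_le_pow_left h2 s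
      _ = s ^ s * (d + 1 - s) ^ s := mul_pow _ _ _
      _ ≤ _ := Nat.mul_le_mul_left _ (h1.trans (Nat.le_succ _))
  · calc d ^ s ≤ s ^ s := Nat.pow_le_pow_left (by omega) s
      _ ≤ _ := Nat.le_mul_of_pos_right _ (Nat.succ_pos _)

/-- The Kővári–Sós–Turán theorem. -/
theorem CommonNeighborsLE.pow_le {V : Type*} [Fintype V] {Γ : SimpleGraph V} {s D : ℕ} (hs : 1 ≤ s)
    (h : Γ.CommonNeighborsLE s D) :
    (2 * Γ.edgeSet.ncard) ^ s ≤
      s ^ s * (s.factorial * D + 1) * Fintype.card V ^ (2 * s - 1) := by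
  classical
  set n := Fintype.card V with hn
  -- Double count the pairs of a vertex and an `s`-set of its neighbors.
  have hdc : ∑ v : V, (Γ.degree v).choose s ≤ D * n ^ s := by
    have h1 := Finset.sum_card_bipartiteAbove_eq_sum_card_bipartiteBelow
      (s := (Finset.univ : Finset V)) (t := Finset.univ.powersetCard s)
      (fun v (A : Finset V) => ∀ a ∈ A, Γ.Adj a v)
    have h2 : ∀ v : V, ((Finset.univ.powersetCard s).bipartiteAbove
        (fun v (A : Finset V) => ∀ a ∈ A, Γ.Adj a v) v).card = (Γ.degree v).choose s := by
      intro v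
      rw [← Γ.card_neighborFinset_eq_degree, ← Finset.card_powersetCard]
      congr 1
      ext A
      simp only [Finset.bipartiteAbove, Finset.mem_filter, Finset.mem_powersetCard,
        Finset.subset_iff, mem_neighborFinset, Finset.mem_univ, implies_true, true_and]
      rw [and_comm]
      simp only [Γ.adj_comm]
    simp only [h2] at h1
    rw [h1]
    calc _ ≤ ∑ A ∈ (Finset.univ : Finset V).powersetCard s, D := by
          refine Finset.sum_le_sum fun A hA => ?_
          refine le_trans (le_of_eq ?_) (h A (Finset.mem_powersetCard.1 hA).2)
          rw [← Set.ncard_coe_finset]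
          congr 1
          ext x
          simp [Finset.bipartiteBelow]
      _ = n.choose s * D := by simp [hn]
      _ ≤ D * n ^ s := by
          rw [mul_comm]
          exact Nat.mul_le_mul_left _ (Nat.choose_le_pow n s)
  have hpow : ∑ v : V, Γ.degree v ^ s ≤ s ^ s * (s.factorial * D + 1) * n ^ s := by
    calc _ ≤ ∑ v : V, s ^ s * (s.factorial * (Γ.degree v).choose s + 1) :=
          Finset.sum_le_sum fun v _ => Nat.pow_le_mul_choose_add_one _ _
      _ = s ^ s * (s.factorial * ∑ v : V, (Γ.degree v).choose s + n) := by
          rw [← Finset.mul_sum, Finset.sum_add_distrib, Finset.mul_sum]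
          simp [hn]
      _ ≤ s ^ s * (s.factorial * (D * n ^ s) + n ^ s) := by
          gcongr
          exact Nat.le_self_pow (by omega) n
      _ = _ := by ring
  rw [← Γ.coe_edgeFinset, Set.ncard_coe_finset, ← Γ.sum_degrees_eq_twice_card_edges]
  obtain ⟨k, rfl⟩ : ∃ k, s = k + 1 := ⟨s - 1, by omega⟩
  calc _ ≤ n ^ k * ∑ v : V, Γ.degree v ^ (k + 1) :=
        pow_sum_le_card_mul_sum_pow (fun _ _ => Nat.zero_le _) k
    _ ≤ n ^ k * ((k + 1) ^ (k + 1) * ((k + 1).factorial * D + 1) * n ^ (k + 1)) :=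
        Nat.mul_le_mul_left _ hpow
    _ = _ := by
        rw [show 2 * (k + 1) - 1 = k + (k + 1) by omega, pow_add]
        ring

end SimpleGraph

/-! ### Primes and norm graphs -/

/-- Bertrand's postulate, used to pass from orders `K * p ^ s` to all large `n` at the cost of a
constant. -/
theorem exists_prime_mul_pow_le (s K : ℕ) (hs : 1 ≤ s) (hK : 1 ≤ K) : ∃ C : ℝ, 0 < C ∧
    ∀ᶠ n : ℕ in atTop, ∃ p : ℕ, p.Prime ∧ K * p ^ s ≤ n ∧ (n : ℝ) ^ (1 / (s : ℝ)) ≤ C * p := by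
  have hs' : (0 : ℝ) < 1 / s := by positivity
  have hK' : (0 : ℝ) < K := by exact_mod_cast hK
  refine ⟨2 * (K : ℝ) ^ (1 / (s : ℝ)), by positivity, ?_⟩
  have hlim : Tendsto (fun n : ℕ => ((n : ℝ) / K) ^ (1 / (s : ℝ))) atTop atTop :=
    (tendsto_rpow_atTop hs').comp (tendsto_natCast_atTop_atTop.atTop_div_const hK')
  filter_upwards [hlim.eventually_ge_atTop 2] with n hn
  set y := ((n : ℝ) / K) ^ (1 / (s : ℝ)) with hy
  set m := ⌊y / 2⌋₊ with hm
  have hm1 : m ≠ 0 := by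
    have : 1 ≤ m := Nat.le_floor (by push_cast; linarith)
    omega
  obtain ⟨p, hp, hmp, hp2⟩ := Nat.exists_prime_lt_and_le_two_mul m hm1
  have hys : y ^ s = n / K := by
    rw [hy, ← Real.rpow_natCast, ← Real.rpow_mul (by positivity)]
    rw [one_div_mul_cancel (by positivity), Real.rpow_one]
  have hmy : (m : ℝ) ≤ y / 2 := Nat.floor_le (by positivity)
  refine ⟨p, hp, ?_, ?_⟩
  · have h1 : (p : ℝ) ≤ y := by
      have : (p : ℝ) ≤ 2 * m := by exact_mod_cast hp2
      linarith
    have h2 : (p : ℝ) ^ s ≤ n / K := hys ▸ pow_le_pow_left₀ (by positivity) h1 s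
    rw [le_div_iff₀ hK'] at h2
    have : ((K * p ^ s : ℕ) : ℝ) ≤ n := by push_cast; linarith
    exact_mod_cast this
  · have h1 : y / 2 < m + 1 := Nat.lt_floor_add_one _
    have h2 : (m : ℝ) + 1 ≤ p := by exact_mod_cast hmp
    have h3 : (n : ℝ) ^ (1 / (s : ℝ)) = (K : ℝ) ^ (1 / (s : ℝ)) * y := by
      rw [hy, ← Real.mul_rpow (by positivity) (by positivity), mul_div_cancel₀ _ hK'.ne']
    rw [h3]
    have h4 : 0 < (K : ℝ) ^ (1 / (s : ℝ)) := by positivity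
    nlinarith

open SimpleGraph

/-- In the norm graph of Kollár, Rónyai and Szabó, `a` and `b` are adjacent if `N (a + b) = c`. A
common neighbor `x` of `f i` solves the system with `y j = x ^ p ^ j` and coefficients `-(f i) ^ p ^
j`, which differ for different `i` because Frobenius is injective. -/
theorem exists_norm_graph (s : ℕ) (hs : 1 ≤ s) : ∃ D : ℕ, ∀ p : ℕ, p.Prime →
    ∃ (V : Type) (_ : Fintype V) (Γ : SimpleGraph V), Fintype.card V = p ^ s ∧
      p ^ (2 * s - 1) ≤ 4 * Γ.edgeSet.ncard ∧ Γ.CommonNeighborsLE s D := by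
  classical
  obtain ⟨D, hD⟩ := NormSystem.exists_card_le (Fin s) ⟨0, hs⟩
  refine ⟨D, fun p hp => ?_⟩
  have : Fact p.Prime := ⟨hp⟩
  let L := GaloisField p s
  have : Fintype L := Fintype.ofFinite L
  have hcard : Fintype.card L = p ^ s := by
    rw [Fintype.card_eq_nat_card]; exact GaloisField.card p s (by omega)
  let N : L → ZMod p := Algebra.norm (ZMod p)
  have hN : ∀ x : L, algebraMap (ZMod p) L (N x) = ∏ j : Fin s, x ^ (p ^ (j : ℕ)) := by
    intro x
    rw [FiniteField.algebraMap_norm_eq_prod_pow, GaloisField.finrank p (by omega), Nat.card_zmod,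
      Finset.prod_range]
  -- Choosing the most frequent value `c` of the norm on sums of distinct elements avoids counting
  -- the fibers of the norm.
  have hpig := Finset.exists_le_card_fiber_of_mul_le_card_of_maps_to
    (s := Finset.univ.filter fun q : L × L => q.1 ≠ q.2) (t := (Finset.univ : Finset (ZMod p)))
    (f := fun q => N (q.1 + q.2)) (n := p ^ (2 * s - 1) - p ^ (s - 1)) (fun _ _ => Finset.mem_univ _)
    ⟨0, Finset.mem_univ _⟩ (by
      have : (Finset.univ.filter fun q : L × L => q.1 ≠ q.2) = Finset.univ.offDiag := by
        ext q; simp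
      rw [this, Finset.offDiag_card, Finset.card_univ, Finset.card_univ, hcard, ZMod.card,
        Nat.mul_sub, ← pow_succ', ← pow_succ', ← pow_add]
      apply le_of_eq
      congr 2 <;> omega)
  obtain ⟨c, -, hc⟩ := hpig
  let Γ : SimpleGraph L :=
    { Adj := fun a b => a ≠ b ∧ N (a + b) = c
      symm := ⟨fun a b h => ⟨h.1.symm, by rw [add_comm]; exact h.2⟩⟩
      loopless := ⟨fun a h => h.1 rfl⟩ }
  refine ⟨L, inferInstance, Γ, hcard, ?_, ?_⟩
  · rw [Finset.filter_filter] at hc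
    have h2 := card_filter_adj Γ
    have h3 : p ^ (2 * s - 1) - p ^ (s - 1) ≤ 2 * Γ.edgeSet.ncard := by
      rw [← h2]
      convert hc
    have h4 : 2 * p ^ (s - 1) ≤ p ^ (2 * s - 1) := by
      rw [show 2 * s - 1 = (s - 1) + 1 + (s - 1) by omega, pow_add, pow_succ']
      refine Nat.mul_le_mul_right _ (hp.two_le.trans ?_)
      exact Nat.le_mul_of_pos_right _ (pow_pos hp.pos _)
    omega
  · intro A hA
    let f : Fin s → L := fun i => ((A.equivFinOfCardEq hA).symm i : L)
    have hf : Function.Injective f := Subtype.val_injective.comp (Equiv.injective _)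
    rw [← Set.Finite.coe_toFinset (Set.toFinite {x | ∀ a ∈ A, Γ.Adj a x}), Set.ncard_coe_finset]
    refine hD L (fun i j => -(f i) ^ (p ^ (j : ℕ))) (fun _ => algebraMap (ZMod p) L c) ?_ _ ?_
    · intro i i' j h heq
      rw [neg_inj] at heq
      exact h (hf (iterateFrobenius_inj L p j heq))
    · intro x hx
      rw [Set.Finite.mem_toFinset] at hx
      refine ⟨fun j => x ^ (p ^ (j : ℕ)), by simp, fun i => ?_⟩
      have h1 := (hx (f i) (Subtype.coe_prop _)).2
      rw [← h1, hN]
      refine Finset.prod_congr rfl fun j _ => ?_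
      rw [add_pow_char_pow, sub_neg_eq_add, add_comm]

/-! ### Colorings and their copies of books -/

theorem lt_familyNumber {n : ℕ} {V : Type u} {G : SimpleGraph V} {F : GraphFamily.{u}}
    (c : TopEdgeLabeling (Fin n) ℕ)
    (h : ¬ ∃ φ : Copy G (⊤ : SimpleGraph (Fin n)), IsFamilyColored F c φ) :
    (Set.range c).ncard < familyNumber n G F := by
  by_contra! hle
  have hne : {k : ℕ | 1 ≤ k ∧ ∀ c : TopEdgeLabeling (Fin n) ℕ, k ≤ (Set.range c).ncard →
      ∃ φ : Copy G (⊤ : SimpleGraph (Fin n)), IsFamilyColored F c φ}.Nonempty := by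
    -- More colors than edges never occur, so this bound works vacuously.
    refine ⟨Nat.card (⊤ : SimpleGraph (Fin n)).edgeSet + 1, Nat.succ_pos _, fun c' hc' => ?_⟩
    have : (Set.range c').ncard ≤ Nat.card (⊤ : SimpleGraph (Fin n)).edgeSet := by
      exact Finite.card_range_le (f := (c' : (⊤ : SimpleGraph (Fin n)).edgeSet → ℕ))
    omega
  exact h ((Nat.sInf_mem hne).2 c hle)

theorem familyNumber_le {n k : ℕ} {V : Type u} {G : SimpleGraph V} {F : GraphFamily.{u}}
    (h : ∀ c : TopEdgeLabeling (Fin n) ℕ, k < (Set.range c).ncard →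
      ∃ φ : Copy G (⊤ : SimpleGraph (Fin n)), IsFamilyColored F c φ) :
    familyNumber n G F ≤ k + 1 :=
  Nat.sInf_le ⟨Nat.succ_pos _, fun c hc => h c hc⟩

/-- The edges of `Γ` receive distinct nonzero colors and all other edges color zero. -/
noncomputable def SimpleGraph.rainbowLabeling {n : ℕ} (Γ : SimpleGraph (Fin n)) :
    TopEdgeLabeling (Fin n) ℕ := by
  classical exact fun e => if (e : Sym2 (Fin n)) ∈ Γ.edgeSet then
    (Fintype.equivFin (Sym2 (Fin n)) e : ℕ) + 1 else 0

theorem SimpleGraph.rainbowLabeling_eq_zero {n : ℕ} (Γ : SimpleGraph (Fin n)) (e) :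
    Γ.rainbowLabeling e = 0 ↔ (e : Sym2 (Fin n)) ∉ Γ.edgeSet := by
  unfold rainbowLabeling
  split_ifs with h <;> simp [h]

theorem SimpleGraph.ncard_edgeSet_le_range {n : ℕ} (Γ : SimpleGraph (Fin n)) :
    Γ.edgeSet.ncard ≤ (Set.range Γ.rainbowLabeling).ncard := by
  classical
  refine Set.ncard_le_ncard_of_injOn
    (fun e => (Fintype.equivFin (Sym2 (Fin n)) e : ℕ) + 1) ?_ ?_ (Set.finite_range (Γ.rainbowLabeling : (⊤ : SimpleGraph (Fin n)).edgeSet → ℕ))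
  · intro e he
    refine ⟨⟨e, edgeSet_mono (le_top : Γ ≤ ⊤) he⟩, ?_⟩
    simp [rainbowLabeling, he]
  · intro e _ e' _ h
    simpa [Fin.val_inj] using h

/-- The edges of a given color on a copy of a graph. -/
theorem labelGraph_pullback_adj {n : ℕ} {V : Type u} {G : SimpleGraph V}
    (c : TopEdgeLabeling (Fin n) ℕ) (φ : Copy G (⊤ : SimpleGraph (Fin n))) (i : ℕ) (x y : V) :
    ((EdgeLabeling.pullback c φ.toHom).labelGraph i).Adj x y ↔
      ∃ h : G.Adj x y, c ⟨s(φ x, φ y), φ.toHom.map_adj h⟩ = i :=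
  EdgeLabeling.labelGraph_adj x y

theorem IsFamilyColored.of_adj {n : ℕ} {V : Type u} {G : SimpleGraph V} {F : GraphFamily.{u}}
    {c : TopEdgeLabeling (Fin n) ℕ} {φ : Copy G (⊤ : SimpleGraph (Fin n))}
    (h : IsFamilyColored F c φ) {x y : V} (hxy : G.Adj x y) :
    F V ((EdgeLabeling.pullback c φ.toHom).labelGraph (c ⟨s(φ x, φ y), φ.toHom.map_adj hxy⟩)) :=
  h _ ⟨⟨s(x, y), hxy⟩, rfl⟩

/-- A copy is family-colored if the edges of the color of any of its edges form a member. -/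
theorem isFamilyColored_of_adj {n : ℕ} {V : Type u} {G : SimpleGraph V} {F : GraphFamily.{u}}
    {c : TopEdgeLabeling (Fin n) ℕ} {φ : Copy G (⊤ : SimpleGraph (Fin n))}
    (h : ∀ x y (hxy : G.Adj x y), F V ((EdgeLabeling.pullback c φ.toHom).labelGraph
      (c ⟨s(φ x, φ y), φ.toHom.map_adj hxy⟩))) : IsFamilyColored F c φ := by
  rintro _ ⟨⟨e, he⟩, rfl⟩
  induction e using Sym2.inductionOn with
  | _ x y => exact h x y he

@[simp] theorem bookOver_adj_inl {W : Type u} {H : SimpleGraph W} {r : ℕ} (x y : W) :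
    (bookOver H r).Adj (Sum.inl x) (Sum.inl y) ↔ H.Adj x y := by
  simp [bookOver, graphJoin]

@[simp] theorem bookOver_adj_inr {W : Type u} {H : SimpleGraph W} {r : ℕ} (x y : Fin r) :
    ¬ (bookOver H r).Adj (Sum.inr x) (Sum.inr y) := by
  simp [bookOver, graphJoin]

@[simp] theorem bookOver_adj_inl_inr {W : Type u} {H : SimpleGraph W} {r : ℕ} (x : W) (y : Fin r) :
    (bookOver H r).Adj (Sum.inl x) (Sum.inr y) := by
  simp [bookOver, graphJoin]

@[simp] theorem bookOver_adj_inr_inl {W : Type u} {H : SimpleGraph W} {r : ℕ} (x : W) (y : Fin r) :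
    (bookOver H r).Adj (Sum.inr y) (Sum.inl x) := by
  simp [bookOver, graphJoin]

theorem degreeAtMost_of_matchings {t : ℕ} (ht : 1 ≤ t) {V : Type u} {D : SimpleGraph V}
    (h : matchings V D) : degreeAtMost t V D := by
  intro x
  refine le_trans (Set.encard_le_one_iff.2 fun y z hy hz => h.2 x y z hy hz) (by exact_mod_cast ht)

/-- Each spine vertex has at most `t` zero-colored edges to pages, so all but `card W * t` pages are
common neighbors of the spine, and at most `D` pages are. -/
theorem edgeSet_lt_familyNumber_bookOver {n : ℕ} {W : Type u} [Fintype W] {H : SimpleGraph W}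
    {F : GraphFamily.{u}} {r t D : ℕ} (hF : ∀ V G, F V G → degreeAtMost t V G)
    (hr : D + Fintype.card W * t < r) (Γ : SimpleGraph (Fin n))
    (hΓ : Γ.CommonNeighborsLE (Fintype.card W) D) :
    Γ.edgeSet.ncard < familyNumber n (bookOver H r) F := by
  classical
  refine (ncard_edgeSet_le_range Γ).trans_lt (lt_familyNumber _ ?_)
  rintro ⟨φ, hφ⟩
  set E := (EdgeLabeling.pullback Γ.rainbowLabeling φ.toHom).labelGraph 0 with hE
  have hEdeg : ∀ w : W, (Finset.univ.filter fun j : Fin r =>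
      ¬ Γ.Adj (φ (Sum.inl w)) (φ (Sum.inr j))).card ≤ t := by
    intro w
    -- The family condition only concerns colors that occur on the copy, so a zero-colored edge must
    -- be exhibited first.
    by_cases hne : ∃ j : Fin r, ¬ Γ.Adj (φ (Sum.inl w)) (φ (Sum.inr j))
    · obtain ⟨j, hj⟩ := hne
      have h0 : Γ.rainbowLabeling ⟨s(φ (Sum.inl w), φ (Sum.inr j)),
          φ.toHom.map_adj (bookOver_adj_inl_inr w j)⟩ = 0 :=
        (Γ.rainbowLabeling_eq_zero _).2 hj
      have h1 := hF _ _ (hφ.of_adj (bookOver_adj_inl_inr w j))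
      rw [h0, ← hE] at h1
      have h2 := h1 (Sum.inl w)
      have h3 : (((Finset.univ.filter fun j : Fin r =>
          ¬ Γ.Adj (φ (Sum.inl w)) (φ (Sum.inr j))).map ⟨Sum.inr, Sum.inr_injective⟩ :
            Finset (W ⊕ Fin r)) : Set (W ⊕ Fin r)) ⊆ E.neighborSet (Sum.inl w) := by
        intro x hx
        simp only [Finset.coe_map, Set.mem_image, Finset.mem_coe, Finset.mem_filter] at hx
        obtain ⟨k, ⟨-, hk⟩, rfl⟩ := hx
        exact (labelGraph_pullback_adj _ _ _ _ _).2 ⟨bookOver_adj_inl_inr w k,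
          (Γ.rainbowLabeling_eq_zero _).2 hk⟩
      have h4 := (Set.encard_le_encard h3).trans h2
      rw [Set.encard_coe_eq_coe_finsetCard, Finset.card_map] at h4
      exact_mod_cast h4
    · push Not at hne
      rw [Finset.filter_false_of_mem (by simpa using hne)]
      simp
  let A : Finset (Fin n) := Finset.univ.image fun w : W => φ (Sum.inl w)
  have hA : A.card = Fintype.card W := by
    exact (Finset.card_image_of_injective _ (φ.injective.comp Sum.inl_injective)).trans
      Finset.card_univ
  let bad : Finset (Fin r) := Finset.univ.biUnion fun w : W => Finset.univ.filter fun j : Fin r =>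
      ¬ Γ.Adj (φ (Sum.inl w)) (φ (Sum.inr j))
  have hbad : bad.card ≤ Fintype.card W * t := by
    refine Finset.card_biUnion_le_card_mul _ _ _ fun w _ => hEdeg w
  have hgood : (badᶜ).card ≤ D := by
    refine le_trans ?_ (hΓ A hA)
    rw [← Finset.card_image_of_injective _ (φ.injective.comp Sum.inr_injective),
      ← Set.ncard_coe_finset]
    refine Set.ncard_le_ncard ?_ (Set.toFinite _)
    intro x hx a ha
    simp only [Finset.coe_image, Set.mem_image, Finset.mem_coe] at hx
    obtain ⟨j, hj, rfl⟩ := hx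
    obtain ⟨w, -, rfl⟩ := Finset.mem_image.1 ha
    by_contra hcon
    exact (Finset.mem_compl.1 hj) (Finset.mem_biUnion.2 ⟨w, Finset.mem_univ _, by simpa using hcon⟩)
  rw [Finset.card_compl, Fintype.card_fin] at hgood
  omega

/-- Graphs with many edges that realize the Kővári–Sós–Turán exponent. -/
theorem exists_dense_commonNeighborsLE (s : ℕ) (hs : 1 ≤ s) : ∃ D : ℕ, ∃ C : ℝ, 0 < C ∧
    ∀ᶠ n : ℕ in atTop, ∃ Γ : SimpleGraph (Fin n), Γ.CommonNeighborsLE s D ∧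
      (n : ℝ) ^ (2 - 1 / (s : ℝ)) ≤ C * Γ.edgeSet.ncard := by
  obtain ⟨D, hD⟩ := exists_norm_graph s hs
  obtain ⟨C, hC, hev⟩ := exists_prime_mul_pow_le s 1 hs le_rfl
  refine ⟨D, C ^ (2 * s - 1) * 4, by positivity, ?_⟩
  filter_upwards [hev] with n ⟨p, hp, hpn, hnp⟩
  obtain ⟨V, _, Γ, hV, hedge, hcom⟩ := hD p hp
  obtain ⟨e⟩ : Nonempty (V ↪ Fin n) :=
    Function.Embedding.nonempty_of_card_le (by simp only [Fintype.card_fin]; omega)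
  refine ⟨Γ.map e, hcom.map hs e, ?_⟩
  rw [ncard_edgeSet_map]
  have h1 : (n : ℝ) ^ (2 - 1 / (s : ℝ)) = ((n : ℝ) ^ (1 / (s : ℝ))) ^ (2 * s - 1) := by
    rw [← Real.rpow_natCast, ← Real.rpow_mul (by positivity)]
    congr 1
    rw [Nat.cast_sub (by omega)]
    have : (s : ℝ) ≠ 0 := by positivity
    push_cast
    field_simp
  have h2 : ((p ^ (2 * s - 1) : ℕ) : ℝ) ≤ ((4 * Γ.edgeSet.ncard : ℕ) : ℝ) := by
    exact_mod_cast hedge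
  push_cast at h2
  calc (n : ℝ) ^ (2 - 1 / (s : ℝ)) ≤ (C * p) ^ (2 * s - 1) := by
        rw [h1]; exact pow_le_pow_left₀ (by positivity) hnp _
    _ = C ^ (2 * s - 1) * (p : ℝ) ^ (2 * s - 1) := mul_pow _ _ _
    _ ≤ C ^ (2 * s - 1) * (4 * Γ.edgeSet.ncard) := by gcongr
    _ = _ := by ring

theorem rpow_isBigO_familyNumber_bookOver {s t : ℕ} (hs : 1 ≤ s) : ∃ r₀ : ℕ, ∀ (W : Type u) [Fintype W]
    (H : SimpleGraph W) (F : GraphFamily.{u}), Fintype.card W = s →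
      (∀ V G, F V G → degreeAtMost t V G) → ∀ r, r₀ ≤ r →
        (fun n : ℕ => (n : ℝ) ^ (2 - 1 / (s : ℝ))) =O[atTop]
          fun n : ℕ => (familyNumber n (bookOver H r) F : ℝ) := by
  obtain ⟨D, C, hC, hev⟩ := exists_dense_commonNeighborsLE s hs
  refine ⟨D + s * t + 1, fun W _ H F hW hF r hr => IsBigO.of_bound C ?_⟩
  filter_upwards [hev] with n ⟨Γ, hΓ, hn⟩
  subst hW
  have h1 := edgeSet_lt_familyNumber_bookOver (H := H) (r := r) hF (by omega) Γ hΓ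
  rw [Real.norm_of_nonneg (by positivity), Real.norm_of_nonneg (by positivity)]
  refine hn.trans ?_
  have : (Γ.edgeSet.ncard : ℝ) ≤ familyNumber n (bookOver H r) F := by exact_mod_cast h1.le
  gcongr

/-! ### Upper bounds from a rainbow subgraph -/

/-- One edge of each color. -/
theorem exists_rainbow_graph {n : ℕ} (c : TopEdgeLabeling (Fin n) ℕ) :
    ∃ Γ : SimpleGraph (Fin n), Γ.edgeSet.ncard = (Set.range c).ncard ∧
      ∀ e e' : (⊤ : SimpleGraph (Fin n)).edgeSet, (e : Sym2 (Fin n)) ∈ Γ.edgeSet → (e' : Sym2 (Fin n)) ∈ Γ.edgeSet → c e = c e' →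
        e = e' := by
  classical
  choose g hg using fun i : Set.range c => i.2
  have hginj : Function.Injective fun i => (g i : Sym2 (Fin n)) := by
    intro i j h
    have : g i = g j := Subtype.ext h
    exact Subtype.ext (by rw [← hg i, ← hg j, this])
  have hedge : (fromEdgeSet (Set.range fun i => (g i : Sym2 (Fin n)))).edgeSet =
      Set.range fun i => (g i : Sym2 (Fin n)) := by
    rw [edgeSet_fromEdgeSet]
    refine sdiff_eq_left.2 (Set.disjoint_left.2 ?_)
    rintro _ ⟨i, rfl⟩ hd
    exact not_isDiag_of_mem_edgeSet _ (g i).2 hd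
  refine ⟨fromEdgeSet (Set.range fun i => (g i : Sym2 (Fin n))), ?_, ?_⟩
  · rw [hedge, ← Set.image_univ, Set.ncard_image_of_injective _ hginj, Set.ncard_univ,
      Nat.card_coe_set_eq]
  · intro e e' he he' h
    rw [hedge] at he he'
    obtain ⟨i, hi⟩ := he
    obtain ⟨j, hj⟩ := he'
    have hi' : g i = e := Subtype.ext hi
    have hj' : g j = e' := Subtype.ext hj
    have hij : i = j := Subtype.ext (by rw [← hg i, ← hg j, hi', hj', h])
    rw [← hi', ← hj', hij]

/-- Once the bad pages are discarded, a color class is either a single cross edge or lies inside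
`H`; `hcross` and `hH` treat these two kinds. -/
theorem exists_isFamilyColored_bookOver {n : ℕ} {W : Type u} [Fintype W] {H : SimpleGraph W}
    {F : GraphFamily.{u}} {r : ℕ}
    (hcross : ∀ (w : W) (j : Fin r) (D : SimpleGraph (W ⊕ Fin r)), D ≠ ⊥ →
      (∀ x y, D.Adj x y → s(x, y) = s(Sum.inl w, Sum.inr j)) → F _ D)
    (hH : ∀ D : SimpleGraph (W ⊕ Fin r), D ≠ ⊥ →
      (∀ x y, D.Adj x y → ∃ a b, H.Adj a b ∧ x = Sum.inl a ∧ y = Sum.inl b) → F _ D)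
    (c : TopEdgeLabeling (Fin n) ℕ) (Γ : SimpleGraph (Fin n))
    (hrainbow : ∀ e e' : (⊤ : SimpleGraph (Fin n)).edgeSet, (e : Sym2 (Fin n)) ∈ Γ.edgeSet → (e' : Sym2 (Fin n)) ∈ Γ.edgeSet →
      c e = c e' → e = e')
    (hΓ : ¬ Γ.CommonNeighborsLE (Fintype.card W) (r + Fintype.card W * Fintype.card W)) :
    ∃ φ : Copy (bookOver H r) (⊤ : SimpleGraph (Fin n)), IsFamilyColored F c φ := by
  classical
  simp only [CommonNeighborsLE, not_forall, not_le] at hΓ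
  obtain ⟨A, hA, hcard⟩ := hΓ
  set X := (Set.toFinite {x | ∀ a ∈ A, Γ.Adj a x}).toFinset with hX
  have hXmem : ∀ x, x ∈ X ↔ ∀ a ∈ A, Γ.Adj a x := fun x => by simp [hX]
  have hXcard : r + Fintype.card W * Fintype.card W < X.card := by
    rwa [← Set.ncard_coe_finset, hX, Set.Finite.coe_toFinset]
  let bad : Finset (Fin n) := X.filter fun x => ∃ q ∈ A ×ˢ A, ∃ a ∈ A, ∃ (h : a ≠ x) (h' : q.1 ≠ q.2),
    c ⟨s(a, x), h⟩ = c ⟨s(q.1, q.2), h'⟩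
  -- Send a bad page to a pair in `A` with the color of one of its edges to `A`. The color
  -- determines that edge of `Γ`, hence the page.
  have hbad : bad.card ≤ Fintype.card W * Fintype.card W := by
    rw [← hA, ← Finset.card_product]
    choose! f hf using fun x (hx : x ∈ bad) => (Finset.mem_filter.1 hx).2
    refine Finset.card_le_card_of_injOn f (fun x hx => (hf x hx).1) ?_
    intro x hx y hy hxy
    obtain ⟨-, a, ha, hax, h', hc⟩ := hf x hx
    obtain ⟨-, b, hb, hby, h'', hc'⟩ := hf y hy
    have hxX := (Finset.mem_filter.1 hx).1
    have hyX := (Finset.mem_filter.1 hy).1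
    have heq := hrainbow ⟨s(a, x), hax⟩ ⟨s(b, y), hby⟩ ((hXmem x).1 hxX a ha) ((hXmem y).1 hyX b hb)
      (by rw [hc, hc']; congr 2; simp only [hxy])
    have heq' : s(a, x) = s(b, y) := congrArg Subtype.val heq
    rcases Sym2.eq_iff.1 heq' with ⟨-, h⟩ | ⟨h, -⟩
    · exact h
    · exact absurd ((hXmem y).1 hyX a ha) (h ▸ Γ.irrefl)
  have hgood : r ≤ (X \ bad).card := by
    have := Finset.le_card_sdiff bad X
    omega
  obtain ⟨P, hP, hPr⟩ := Finset.exists_subset_card_eq hgood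
  let α : W ≃ A := Fintype.equivOfCardEq (by simp [hA])
  let β : Fin r ≃ P := Fintype.equivOfCardEq (by simp [hPr])
  have hadj : ∀ w j, Γ.Adj (α w) (β j) := fun w j =>
    (hXmem _).1 (Finset.mem_sdiff.1 (hP (β j).2)).1 _ (α w).2
  have hinj : Function.Injective (Sum.elim (fun w => (α w : Fin n)) fun j => (β j : Fin n)) := by
    refine Function.Injective.sumElim (Subtype.val_injective.comp α.injective)
      (Subtype.val_injective.comp β.injective) fun w j => (hadj w j).ne
  let φ : Copy (bookOver H r) (⊤ : SimpleGraph (Fin n)) :=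
    ⟨⟨_, fun h => hinj.ne h.ne⟩, hinj⟩
  have hcH : ∀ w j a b (h : φ (Sum.inl w) ≠ φ (Sum.inr j)) (h' : φ (Sum.inl a) ≠ φ (Sum.inl b)),
      c ⟨s(φ (Sum.inl w), φ (Sum.inr j)), h⟩ ≠ c ⟨s(φ (Sum.inl a), φ (Sum.inl b)), h'⟩ := by
    intro w j a b h h' heq
    refine (Finset.mem_sdiff.1 (hP (β j).2)).2 (Finset.mem_filter.2
      ⟨(Finset.mem_sdiff.1 (hP (β j).2)).1, ((α a : Fin n), (α b : Fin n)), ?_, α w, (α w).2, h, h', heq⟩)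
    exact Finset.mem_product.2 ⟨(α a).2, (α b).2⟩
  have hcc : ∀ w j w' j' (h : φ (Sum.inl w) ≠ φ (Sum.inr j)) (h' : φ (Sum.inl w') ≠ φ (Sum.inr j')),
      c ⟨s(φ (Sum.inl w), φ (Sum.inr j)), h⟩ = c ⟨s(φ (Sum.inl w'), φ (Sum.inr j')), h'⟩ →
        w = w' ∧ j = j' := by
    intro w j w' j' h h' heq
    have h1 : s(φ (Sum.inl w), φ (Sum.inr j)) = s(φ (Sum.inl w'), φ (Sum.inr j')) :=
      congrArg Subtype.val (hrainbow ⟨s(φ (Sum.inl w), φ (Sum.inr j)), h⟩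
        ⟨s(φ (Sum.inl w'), φ (Sum.inr j')), h'⟩ (hadj w j) (hadj w' j') heq)
    rcases Sym2.eq_iff.1 h1 with ⟨h2, h3⟩ | ⟨h2, -⟩
    · exact ⟨Sum.inl_injective (φ.injective h2), Sum.inr_injective (φ.injective h3)⟩
    · exact absurd (φ.injective h2) (by simp)
  have hswap : ∀ (x y : Fin n) (h : x ≠ y), c ⟨s(x, y), h⟩ = c ⟨s(y, x), h.symm⟩ := by
    intro x y h
    congr 2
    exact Sym2.eq_swap
  have hcrossφ : ∀ w j, F _ ((EdgeLabeling.pullback c φ.toHom).labelGraph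
      (c ⟨s(φ (Sum.inl w), φ (Sum.inr j)), φ.toHom.map_adj (bookOver_adj_inl_inr w j)⟩)) := by
    intro w j
    refine hcross w j _ ?_ ?_
    · intro hbot
      have : ((EdgeLabeling.pullback c φ.toHom).labelGraph
        (c ⟨s(φ (Sum.inl w), φ (Sum.inr j)), φ.toHom.map_adj (bookOver_adj_inl_inr w j)⟩)).Adj
          (Sum.inl w) (Sum.inr j) :=
        (labelGraph_pullback_adj _ _ _ _ _).2 ⟨bookOver_adj_inl_inr w j, rfl⟩
      rw [hbot] at this
      exact this
    · intro x y hxy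
      obtain ⟨hG, hc⟩ := (labelGraph_pullback_adj _ _ _ _ _).1 hxy
      rcases x with x | x <;> rcases y with y | y
      · exact absurd hc.symm (hcH _ _ _ _ _ _)
      · obtain ⟨rfl, rfl⟩ := hcc _ _ _ _ _ _ hc
        rfl
      · rw [hswap] at hc
        obtain ⟨rfl, rfl⟩ := hcc _ _ _ _ _ _ hc
        exact Sym2.eq_swap
      · exact absurd hG (bookOver_adj_inr _ _)
  refine ⟨φ, isFamilyColored_of_adj fun x y hxy => ?_⟩
  rcases x with x | x <;> rcases y with y | y
  · refine hH _ ?_ ?_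
    · intro hbot
      have : ((EdgeLabeling.pullback c φ.toHom).labelGraph
        (c ⟨s(φ (Sum.inl x), φ (Sum.inl y)), φ.toHom.map_adj hxy⟩)).Adj (Sum.inl x) (Sum.inl y) :=
        (labelGraph_pullback_adj _ _ _ _ _).2 ⟨hxy, rfl⟩
      rw [hbot] at this
      exact this
    · intro x' y' hxy'
      obtain ⟨hG, hc⟩ := (labelGraph_pullback_adj _ _ _ _ _).1 hxy'
      rcases x' with x' | x' <;> rcases y' with y' | y'
      · exact ⟨x', y', (bookOver_adj_inl _ _).1 hG, rfl, rfl⟩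
      · exact absurd hc (hcH _ _ _ _ _ _)
      · rw [hswap] at hc
        exact absurd hc (hcH _ _ _ _ _ _)
      · exact absurd hG (bookOver_adj_inr _ _)
  · exact hcrossφ x y
  · have := hcrossφ y x
    rwa [hswap] at this
  · exact absurd hxy (bookOver_adj_inr _ _)

theorem SimpleGraph.CommonNeighborsLE.exists_le_rpow (s D : ℕ) (hs : 1 ≤ s) : ∃ C : ℝ, 0 < C ∧
    ∀ (n : ℕ) (Γ : SimpleGraph (Fin n)), Γ.CommonNeighborsLE s D →
      (Γ.edgeSet.ncard : ℝ) ≤ C * (n : ℝ) ^ (2 - 1 / (s : ℝ)) := by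
  refine ⟨((s ^ s * (s.factorial * D + 1) : ℕ) : ℝ) ^ (1 / (s : ℝ)), by positivity, fun n Γ h => ?_⟩
  have h1 := h.pow_le hs
  rw [Fintype.card_fin] at h1
  have h2 : (Γ.edgeSet.ncard : ℝ) ^ s ≤
      ((s ^ s * (s.factorial * D + 1) : ℕ) : ℝ) * (n : ℝ) ^ (2 * s - 1) := by
    have h3 : Γ.edgeSet.ncard ^ s ≤ s ^ s * (s.factorial * D + 1) * n ^ (2 * s - 1) :=
      (Nat.pow_le_pow_left (by omega) s).trans h1
    exact_mod_cast h3
  have h4 : (Γ.edgeSet.ncard : ℝ) = ((Γ.edgeSet.ncard : ℝ) ^ s) ^ (1 / (s : ℝ)) := by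
    rw [one_div, Real.pow_rpow_inv_natCast (by positivity) (by omega)]
  have h5 : (n : ℝ) ^ (2 - 1 / (s : ℝ)) = ((n : ℝ) ^ (2 * s - 1)) ^ (1 / (s : ℝ)) := by
    rw [← Real.rpow_natCast, ← Real.rpow_mul (by positivity)]
    congr 1
    rw [Nat.cast_sub (by omega)]
    have : (s : ℝ) ≠ 0 := by positivity
    push_cast
    field_simp
  rw [h4, h5, ← Real.mul_rpow (by positivity) (by positivity)]
  exact Real.rpow_le_rpow (by positivity) h2 (by positivity)

theorem familyNumber_bookOver_isBigO_rpow {W : Type u} [Fintype W] {H : SimpleGraph W}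
    {F : GraphFamily.{u}} {r : ℕ} (hW : 1 ≤ Fintype.card W)
    (hcross : ∀ (w : W) (j : Fin r) (D : SimpleGraph (W ⊕ Fin r)), D ≠ ⊥ →
      (∀ x y, D.Adj x y → s(x, y) = s(Sum.inl w, Sum.inr j)) → F _ D)
    (hH : ∀ D : SimpleGraph (W ⊕ Fin r), D ≠ ⊥ →
      (∀ x y, D.Adj x y → ∃ a b, H.Adj a b ∧ x = Sum.inl a ∧ y = Sum.inl b) → F _ D) :
    (fun n : ℕ => (familyNumber n (bookOver H r) F : ℝ)) =O[atTop]
      fun n : ℕ => (n : ℝ) ^ (2 - 1 / (Fintype.card W : ℝ)) := by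
  obtain ⟨C, hC, hbound⟩ := CommonNeighborsLE.exists_le_rpow (Fintype.card W)
    (r + Fintype.card W * Fintype.card W) hW
  refine IsBigO.of_bound (C + 1) ?_
  filter_upwards [eventually_ge_atTop 1] with n hn
  rw [Real.norm_of_nonneg (by positivity), Real.norm_of_nonneg (by positivity)]
  set y := (n : ℝ) ^ (2 - 1 / (Fintype.card W : ℝ)) with hy
  have hy1 : 1 ≤ y := by
    refine Real.one_le_rpow (by exact_mod_cast hn) ?_
    have : (1 : ℝ) / Fintype.card W ≤ 1 := by
      rw [div_le_one (by positivity)]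
      exact_mod_cast hW
    linarith
  have hle : familyNumber n (bookOver H r) F ≤ ⌊C * y⌋₊ + 1 := by
    refine familyNumber_le fun c hc => ?_
    obtain ⟨Γ, hcard, hrainbow⟩ := exists_rainbow_graph c
    refine exists_isFamilyColored_bookOver hcross hH c Γ hrainbow fun hΓ => ?_
    have h1 := hbound n Γ hΓ
    rw [hcard] at h1
    exact absurd (Nat.le_floor h1) (not_le.2 hc)
  have h2 : (familyNumber n (bookOver H r) F : ℝ) ≤ ⌊C * y⌋₊ + 1 := by exact_mod_cast hle
  have h3 : (⌊C * y⌋₊ : ℝ) ≤ C * y := Nat.floor_le (by positivity)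
  nlinarith

/-! ### Books with at least three pages -/

theorem isFamilyColored_matchings_iff {n : ℕ} {V : Type u} {G : SimpleGraph V}
    {c : TopEdgeLabeling (Fin n) ℕ} {φ : Copy G (⊤ : SimpleGraph (Fin n))} :
    IsFamilyColored matchings c φ ↔ ∀ x y z (hy : G.Adj x y) (hz : G.Adj x z),
      c ⟨s(φ x, φ y), φ.toHom.map_adj hy⟩ = c ⟨s(φ x, φ z), φ.toHom.map_adj hz⟩ → y = z := by
  constructor
  · intro h x y z hy hz heq
    exact (h.of_adj hy).2 x y z ((labelGraph_pullback_adj _ _ _ _ _).2 ⟨hy, rfl⟩)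
      ((labelGraph_pullback_adj _ _ _ _ _).2 ⟨hz, heq.symm⟩)
  · intro h
    refine isFamilyColored_of_adj fun x y hxy => ⟨fun hbot => ?_, fun x' y' z' hy' hz' => ?_⟩
    · have : ((EdgeLabeling.pullback c φ.toHom).labelGraph
        (c ⟨s(φ x, φ y), φ.toHom.map_adj hxy⟩)).Adj x y :=
        (labelGraph_pullback_adj _ _ _ _ _).2 ⟨hxy, rfl⟩
      rw [hbot] at this
      exact this
    · obtain ⟨hy, hcy⟩ := (labelGraph_pullback_adj _ _ _ _ _).1 hy'
      obtain ⟨hz, hcz⟩ := (labelGraph_pullback_adj _ _ _ _ _).1 hz'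
      exact h x' y' z' hy hz (hcy.trans hcz.symm)

/-- If the spine is in `Γ`, each end has at most one zero-colored page edge, so one of three pages
closes a triangle. Otherwise the spine has color zero, so every page edge is in `Γ` and two pages
give a 4-cycle. -/
theorem edgeSet_lt_Lr_book {n t : ℕ} (ht : 3 ≤ t) (Γ : SimpleGraph (Fin n))
    (hΓ : Γ.CommonNeighborsLE 2 1) (hfree : ∀ x y z, Γ.Adj x y → Γ.Adj x z → ¬ Γ.Adj y z) :
    Γ.edgeSet.ncard < Lr n (book t) := by
  classical
  refine (ncard_edgeSet_le_range Γ).trans_lt (lt_familyNumber _ ?_)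
  rintro ⟨φ, hφ⟩
  rw [isFamilyColored_matchings_iff] at hφ
  have key : ∀ x y z, (book t).Adj x y → (book t).Adj x z → y ≠ z →
      Γ.Adj (φ x) (φ y) ∨ Γ.Adj (φ x) (φ z) := by
    intro x y z hy hz hyz
    by_contra! hcon
    refine hyz (hφ x y z hy hz ?_)
    exact ((Γ.rainbowLabeling_eq_zero ⟨s(φ x, φ y), _⟩).2 hcon.1).trans
      ((Γ.rainbowLabeling_eq_zero ⟨s(φ x, φ z), _⟩).2 hcon.2).symm
  have huv : (book t).Adj (Sum.inl 0) (Sum.inl 1) := by simp [book]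
  have hw : ∀ (i : Fin 2) (j : Fin t), (book t).Adj (Sum.inl i) (Sum.inr j) :=
    fun i j => bookOver_adj_inl_inr i j
  let j0 : Fin t := ⟨0, by omega⟩
  let j1 : Fin t := ⟨1, by omega⟩
  let j2 : Fin t := ⟨2, by omega⟩
  have h01 : (Sum.inr j0 : Fin 2 ⊕ Fin t) ≠ Sum.inr j1 := by simp [j0, j1]
  have h02 : (Sum.inr j0 : Fin 2 ⊕ Fin t) ≠ Sum.inr j2 := by simp [j0, j2]
  have h12 : (Sum.inr j1 : Fin 2 ⊕ Fin t) ≠ Sum.inr j2 := by simp [j1, j2]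
  by_cases hs : Γ.Adj (φ (Sum.inl 0)) (φ (Sum.inl 1))
  · have htri : ∀ j, ¬ (Γ.Adj (φ (Sum.inl 0)) (φ (Sum.inr j)) ∧
        Γ.Adj (φ (Sum.inl 1)) (φ (Sum.inr j))) := fun j h => hfree _ _ _ hs h.1 h.2
    have a1 := key _ _ _ (hw 0 j0) (hw 0 j1) h01
    have a2 := key _ _ _ (hw 0 j0) (hw 0 j2) h02
    have a3 := key _ _ _ (hw 0 j1) (hw 0 j2) h12
    have b1 := key _ _ _ (hw 1 j0) (hw 1 j1) h01
    have b2 := key _ _ _ (hw 1 j0) (hw 1 j2) h02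
    have b3 := key _ _ _ (hw 1 j1) (hw 1 j2) h12
    have c0 := htri j0
    have c1 := htri j1
    have c2 := htri j2
    tauto
  · have hu : ∀ j, Γ.Adj (φ (Sum.inl 0)) (φ (Sum.inr j)) := fun j =>
      (key _ _ _ huv (hw 0 j) (by simp)).resolve_left hs
    have hv : ∀ j, Γ.Adj (φ (Sum.inl 1)) (φ (Sum.inr j)) := fun j =>
      (key _ _ _ huv.symm (hw 1 j) (by simp)).resolve_left fun h => hs h.symm
    have h1 := hΓ {φ (Sum.inl 0), φ (Sum.inl 1)} (Finset.card_pair (φ.injective.ne (by simp)))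
    have hmem : ∀ j, φ (Sum.inr j) ∈ {x | ∀ a ∈ ({φ (Sum.inl 0), φ (Sum.inl 1)} : Finset (Fin n)),
        Γ.Adj a x} := by
      intro j a ha
      rcases Finset.mem_insert.1 ha with rfl | ha
      · exact hu j
      · rw [Finset.mem_singleton.1 ha]
        exact hv j
    exact h01 (φ.injective ((Set.ncard_le_one (Set.toFinite _)).1 h1 _ (hmem j0) _ (hmem j1)))

/-- The incidence graph of points and non-vertical lines in the affine plane. -/
def affineIncidence (K : Type*) [Field K] : SimpleGraph ((K × K) ⊕ (K × K)) where
  Adj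
    | .inl l, .inr P => P.2 = l.1 * P.1 + l.2
    | .inr P, .inl l => P.2 = l.1 * P.1 + l.2
    | _, _ => False
  symm := ⟨by rintro (l | P) (l' | P') h <;> exact h⟩
  loopless := ⟨by rintro (l | P) h <;> exact h⟩

theorem affineIncidence_triangleFree (K : Type*) [Field K] (x y z)
    (hxy : (affineIncidence K).Adj x y) (hxz : (affineIncidence K).Adj x z) :
    ¬ (affineIncidence K).Adj y z := by
  rcases x with x | x <;> rcases y with y | y <;> rcases z with z | z <;>
    simp_all [affineIncidence]

theorem affineIncidence_commonNeighborsLE (K : Type*) [Field K] :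
    (affineIncidence K).CommonNeighborsLE 2 1 := by
  classical
  intro A hA
  obtain ⟨P, Q, hPQ, rfl⟩ := Finset.card_eq_two.1 hA
  have hsub : {x | ∀ a ∈ ({P, Q} : Finset _), (affineIncidence K).Adj a x}.Subsingleton := by
    intro x hx y hy
    have hPx := hx P (by simp)
    have hQx := hx Q (by simp)
    have hPy := hy P (by simp)
    have hQy := hy Q (by simp)
    rcases P with ⟨a, b⟩ | ⟨a, b⟩ <;> rcases Q with ⟨a', b'⟩ | ⟨a', b'⟩ <;>
      rcases x with ⟨x₁, x₂⟩ | ⟨x₁, x₂⟩ <;> rcases y with ⟨y₁, y₂⟩ | ⟨y₁, y₂⟩ <;>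
      simp only [affineIncidence] at hPx hQx hPy hQy
    -- Only two lines, or two points, can have a common neighbor, by bipartiteness.
    · have h : (a - a') * (x₁ - y₁) = 0 := by linear_combination hQx - hPx + hPy - hQy
      rcases mul_eq_zero.1 h with h | h
      · have haa : a = a' := sub_eq_zero.1 h
        subst haa
        exact absurd (by simp; linear_combination hQx - hPx) hPQ
      · have hxx : x₁ = y₁ := sub_eq_zero.1 h
        subst hxx
        rw [hPx, hPy]
    · have h : (x₁ - y₁) * (a - a') = 0 := by linear_combination hPy - hPx + hQx - hQy
      rcases mul_eq_zero.1 h with h | h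
      · have hxx : x₁ = y₁ := sub_eq_zero.1 h
        subst hxx
        have : x₂ = y₂ := by linear_combination hPy - hPx
        rw [this]
      · have haa : a = a' := sub_eq_zero.1 h
        subst haa
        exact absurd (by rw [hPx, hQx]) hPQ
  exact (Set.ncard_le_one hsub.finite).2 hsub

theorem le_ncard_edgeSet_affineIncidence (K : Type*) [Field K] [Finite K] :
    Nat.card K ^ 3 ≤ (affineIncidence K).edgeSet.ncard := by
  have h : (Set.univ : Set (K × K × K)).ncard ≤ (affineIncidence K).edgeSet.ncard := by
    refine Set.ncard_le_ncard_of_injOn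
      (fun q => s(Sum.inl (q.1, q.2.1), Sum.inr (q.2.2, q.1 * q.2.2 + q.2.1))) ?_ ?_ (Set.toFinite _)
    · intro q _
      simp [affineIncidence]
    · rintro ⟨a, b, x⟩ - ⟨a', b', x'⟩ - h
      simp only [Sym2.eq_iff] at h
      simp_all
  rw [Set.ncard_univ, Nat.card_prod, Nat.card_prod] at h
  calc _ = _ := by ring
    _ ≤ _ := h

theorem SimpleGraph.map_triangleFree {V W : Type*} {Γ : SimpleGraph V} (e : V ↪ W)
    (h : ∀ x y z, Γ.Adj x y → Γ.Adj x z → ¬ Γ.Adj y z) (x y z : W)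
    (hxy : (Γ.map e).Adj x y) (hxz : (Γ.map e).Adj x z) : ¬ (Γ.map e).Adj y z := by
  obtain ⟨-, x, y, hxy, rfl, rfl⟩ := hxy
  obtain ⟨-, x', z, hxz, hx, rfl⟩ := hxz
  obtain rfl := e.injective hx
  rw [map_adj_apply]
  exact h _ _ _ hxy hxz

theorem rpow_isBigO_Lr_book {t : ℕ} (ht : 3 ≤ t) :
    (fun n : ℕ => (n : ℝ) ^ (3 / 2 : ℝ)) =O[atTop] fun n : ℕ => (Lr n (book t) : ℝ) := by
  obtain ⟨C, hC, hev⟩ := exists_prime_mul_pow_le 2 2 (by norm_num) (by norm_num)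
  refine IsBigO.of_bound (C ^ 3) ?_
  filter_upwards [hev] with n ⟨p, hp, hpn, hnp⟩
  have : Fact p.Prime := ⟨hp⟩
  obtain ⟨e⟩ : Nonempty (((ZMod p × ZMod p) ⊕ (ZMod p × ZMod p)) ↪ Fin n) := by
    refine Function.Embedding.nonempty_of_card_le ?_
    simp only [Fintype.card_fin, Fintype.card_sum, Fintype.card_prod, ZMod.card]
    linarith [sq p]
  have h1 := edgeSet_lt_Lr_book ht ((affineIncidence (ZMod p)).map e)
    ((affineIncidence_commonNeighborsLE _).map (by norm_num) e)
    (map_triangleFree e (affineIncidence_triangleFree _))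
  have h2 := le_ncard_edgeSet_affineIncidence (ZMod p)
  rw [ncard_edgeSet_map] at h1
  rw [Nat.card_zmod] at h2
  have h3 : (p : ℝ) ^ 3 ≤ Lr n (book t) := by exact_mod_cast h2.trans h1.le
  rw [Real.norm_of_nonneg (by positivity), Real.norm_of_nonneg (by positivity)]
  have h4 : (n : ℝ) ^ (3 / 2 : ℝ) = ((n : ℝ) ^ (1 / ((2 : ℕ) : ℝ))) ^ 3 := by
    rw [← Real.rpow_natCast, ← Real.rpow_mul (by positivity)]
    norm_num
  calc (n : ℝ) ^ (3 / 2 : ℝ) ≤ (C * p) ^ 3 := by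
        rw [h4]; exact pow_le_pow_left₀ (by positivity) hnp _
    _ = C ^ 3 * (p : ℝ) ^ 3 := mul_pow _ _ _
    _ ≤ _ := by gcongr

/-! ### Books with one or two pages -/

/-- Every edge is colored by its smaller end. -/
def minLabeling (n : ℕ) : TopEdgeLabeling (Fin n) ℕ := fun e => ((e : Sym2 (Fin n)).inf : ℕ)

theorem le_ncard_range_minLabeling (n : ℕ) : n - 1 ≤ (Set.range (minLabeling n)).ncard := by
  rw [← Finset.card_range (n - 1), ← Set.ncard_coe_finset]
  refine Set.ncard_le_ncard ?_
    (Set.finite_range (minLabeling n : (⊤ : SimpleGraph (Fin n)).edgeSet → ℕ))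
  intro k hk
  have hk' : k + 1 < n := by
    have := Finset.mem_range.1 hk
    omega
  refine ⟨⟨s(⟨k, by omega⟩, ⟨k + 1, hk'⟩), by simp⟩, ?_⟩
  simp [minLabeling]

theorem inf_eq_inf_or {α : Type*} [LinearOrder α] (a b c : α) :
    a ⊓ b = a ⊓ c ∨ a ⊓ b = b ⊓ c ∨ a ⊓ c = b ⊓ c := by
  rcases le_total a b with h | h <;> rcases le_total a c with h' | h' <;>
    rcases le_total b c with h'' | h'' <;> simp [*] <;> grind

/-- The two edges at the smallest vertex of a triangle share a color, so no triangle is properly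
colored. -/
theorem le_Lr_book {t : ℕ} (ht : 1 ≤ t) (n : ℕ) : n ≤ Lr n (book t) := by
  have h : n - 1 < Lr n (book t) := by
    refine (le_ncard_range_minLabeling n).trans_lt (lt_familyNumber _ ?_)
    rintro ⟨φ, hφ⟩
    rw [isFamilyColored_matchings_iff] at hφ
    let j : Fin t := ⟨0, ht⟩
    have huv : (book t).Adj (Sum.inl 0) (Sum.inl 1) := by simp [book]
    have huw : (book t).Adj (Sum.inl 0) (Sum.inr j) := bookOver_adj_inl_inr _ _
    have hvw : (book t).Adj (Sum.inl 1) (Sum.inr j) := bookOver_adj_inl_inr _ _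
    have h1 := hφ _ _ _ huv huw
    have h2 := hφ _ _ _ huv.symm hvw
    have h3 := hφ _ _ _ huw.symm hvw.symm
    simp only [minLabeling, Sym2.inf_mk, Fin.val_inj, reduceCtorEq, imp_false, Sum.inl.injEq,
      zero_ne_one] at h1 h2 h3
    rw [inf_comm (φ (Sum.inl 1))] at h2
    rw [inf_comm (φ (Sum.inr j)), inf_comm (φ (Sum.inr j))] at h3
    rcases inf_eq_inf_or (φ (Sum.inl 0)) (φ (Sum.inl 1)) (φ (Sum.inr j)) with h | h | h
    · exact h1 h
    · exact h2 h
    · exact h3 h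
  omega

section ProperBook

variable {V : Type*}

/-- The book with spine `u v` and pages `x`, `y` is properly colored by `d`. -/
def IsProperBook (d : V → V → ℕ) (u v x y : V) : Prop :=
  u ≠ v ∧ u ≠ x ∧ u ≠ y ∧ v ≠ x ∧ v ≠ y ∧ x ≠ y ∧ d u v ≠ d u x ∧ d u v ≠ d u y ∧
    d u v ≠ d v x ∧ d u v ≠ d v y ∧ d u x ≠ d u y ∧ d v x ≠ d v y ∧ d u x ≠ d v x ∧ d u y ≠ d v y

theorem IsProperBook.ne_of_spine {d : V → V → ℕ} (hd : ∀ x y, d x y = d y x) {u v x y p q r : V}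
    (h : IsProperBook d u v x y) (hp : p = u ∨ p = v) (hq : q = u ∨ q = v ∨ q = x ∨ q = y)
    (hr : r = u ∨ r = v ∨ r = x ∨ r = y) (hpq : p ≠ q) (hpr : p ≠ r) (hqr : q ≠ r) :
    d p q ≠ d p r := by
  unfold IsProperBook at h
  have hvu := hd v u
  clear hd
  rcases hp with rfl | rfl <;> grind

theorem IsProperBook.ne_of_page {d : V → V → ℕ} (hd : ∀ x y, d x y = d y x) {u v x y p q r : V}
    (h : IsProperBook d u v x y) (hp : p = x ∨ p = y) (hq : q = u ∨ q = v) (hr : r = u ∨ r = v)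
    (hqr : q ≠ r) : d p q ≠ d p r := by
  unfold IsProperBook at h
  rw [hd p q, hd p r]
  clear hd
  rcases hp with rfl | rfl <;> grind

/-- The colors of the edges inside `S`. -/
def colorsOn (d : V → V → ℕ) (S : Finset V) : Finset ℕ := S.offDiag.image fun q => d q.1 q.2

theorem mem_colorsOn {d : V → V → ℕ} {S : Finset V} {i : ℕ} :
    i ∈ colorsOn d S ↔ ∃ a ∈ S, ∃ b ∈ S, a ≠ b ∧ d a b = i := by
  simp only [colorsOn, Finset.mem_image, Finset.mem_offDiag, Prod.exists]
  grind

variable [DecidableEq V]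

/-- The colors inside `S` that occur only at `v`. -/
def privateColors (d : V → V → ℕ) (S : Finset V) (v : V) : Finset ℕ :=
  colorsOn d S \ colorsOn d (S.erase v)

theorem eq_or_eq_of_mem_privateColors {d : V → V → ℕ} {S : Finset V} {v : V} {i : ℕ}
    (h : i ∈ privateColors d S v) {a b : V} (ha : a ∈ S) (hb : b ∈ S) (hab : a ≠ b)
    (hi : d a b = i) : a = v ∨ b = v := by
  by_contra! hcon
  refine (Finset.mem_sdiff.1 h).2 (mem_colorsOn.2 ⟨a, ?_, b, ?_, hab, hi⟩)
  · exact Finset.mem_erase.2 ⟨hcon.1, ha⟩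
  · exact Finset.mem_erase.2 ⟨hcon.2, hb⟩

theorem exists_of_mem_privateColors {d : V → V → ℕ} (hd : ∀ x y, d x y = d y x) {S : Finset V}
    {v : V} {i : ℕ} (h : i ∈ privateColors d S v) : ∃ x ∈ S, x ≠ v ∧ d v x = i := by
  obtain ⟨a, ha, b, hb, hab, hi⟩ := mem_colorsOn.1 (Finset.mem_sdiff.1 h).1
  rcases eq_or_eq_of_mem_privateColors h ha hb hab hi with rfl | rfl
  · exact ⟨b, hb, hab.symm, hi⟩
  · exact ⟨a, ha, hab, by rw [hd, hi]⟩

/-- Choose a vertex `v` and a private color `c₁` with the fewest edges at `v`, and edges `v x₁`, `v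
x₂`, `v x₃` of distinct private colors. The book on spine `v x₁` with pages `x₂`, `x₃` can fail only
if `x₁ x₂` and `x₁ x₃` share a color. Then a further private color `b` of `x₁` has a strictly
smaller class, against minimality. -/
theorem exists_isProperBook {d : V → V → ℕ} (hd : ∀ x y, d x y = d y x) {S : Finset V}
    (hS : S.Nonempty) (h : ∀ v ∈ S, 2 < (privateColors d S v).card) :
    ∃ u v x y, IsProperBook d u v x y := by
  by_contra! hno
  have hthree : ∀ v ∈ S, ∀ i j, ∃ k ∈ privateColors d S v, k ≠ i ∧ k ≠ j := by
    intro v hv i j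
    by_contra! hcon
    have : privateColors d S v ⊆ {i, j} := by
      intro k hk
      by_cases hki : k = i
      · simp [hki]
      · simp [hcon k hk hki]
    exact absurd ((Finset.card_le_card this).trans Finset.card_le_two) (not_le.2 (h v hv))
  let Q : Finset (V × ℕ) := (S ×ˢ colorsOn d S).filter fun q => q.2 ∈ privateColors d S q.1
  have hQ : ∀ v i, v ∈ S → i ∈ privateColors d S v → (v, i) ∈ Q := fun v i hv hi =>
    Finset.mem_filter.2 ⟨Finset.mem_product.2 ⟨hv, (Finset.mem_sdiff.1 hi).1⟩, hi⟩
  have hQne : Q.Nonempty := by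
    obtain ⟨v, hv⟩ := hS
    obtain ⟨k, hk, -⟩ := hthree v hv 0 0
    exact ⟨_, hQ v k hv hk⟩
  obtain ⟨⟨v, c₁⟩, hv₁, hmin⟩ := Finset.exists_min_image Q
    (fun q => (S.filter fun x => x ≠ q.1 ∧ d q.1 x = q.2).card) hQne
  have hc₁ : c₁ ∈ privateColors d S v := (Finset.mem_filter.1 hv₁).2
  have hv : v ∈ S := (Finset.mem_product.1 (Finset.mem_filter.1 hv₁).1).1
  obtain ⟨c₂, hc₂, hc₂₁, -⟩ := hthree v hv c₁ c₁
  obtain ⟨c₃, hc₃, hc₃₁, hc₃₂⟩ := hthree v hv c₁ c₂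
  obtain ⟨x₁, hx₁, hx₁v, hd₁⟩ := exists_of_mem_privateColors hd hc₁
  obtain ⟨x₂, hx₂, hx₂v, hd₂⟩ := exists_of_mem_privateColors hd hc₂
  obtain ⟨x₃, hx₃, hx₃v, hd₃⟩ := exists_of_mem_privateColors hd hc₃
  have h₁₂ : x₁ ≠ x₂ := by rintro rfl; exact hc₂₁ (hd₂.symm.trans hd₁)
  have h₁₃ : x₁ ≠ x₃ := by rintro rfl; exact hc₃₁ (hd₃.symm.trans hd₁)
  have h₂₃ : x₂ ≠ x₃ := by rintro rfl; exact hc₃₂ (hd₃.symm.trans hd₂)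
  have hpriv : ∀ {c x y}, c ∈ privateColors d S v → x ∈ S → y ∈ S → x ≠ y → x ≠ v → y ≠ v →
      d x y ≠ c := fun hc hx hy hxy hxv hyv heq =>
    (eq_or_eq_of_mem_privateColors hc hx hy hxy heq).elim hxv hyv
  have p₁ := hpriv hc₁ hx₁ hx₂ h₁₂ hx₁v hx₂v
  have p₂ := hpriv hc₂ hx₁ hx₂ h₁₂ hx₁v hx₂v
  have q₁ := hpriv hc₁ hx₁ hx₃ h₁₃ hx₁v hx₃v
  have q₃ := hpriv hc₃ hx₁ hx₃ h₁₃ hx₁v hx₃v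
  have heq : d x₁ x₂ = d x₁ x₃ := by
    by_contra hne
    refine hno v x₁ x₂ x₃ ?_
    unfold IsProperBook
    grind
  obtain ⟨b, hb, hb₁, hb₂⟩ := hthree x₁ hx₁ c₁ (d x₁ x₂)
  -- If `v y` did not have color `c₁`, then `y` with `x₂` or with `x₃` would complete a proper book,
  -- since `v y` cannot have both colors `c₂` and `c₃`.
  have hclass : ∀ y ∈ S, y ≠ x₁ → d x₁ y = b → y ≠ v ∧ d v y = c₁ := by
    intro y hy hyx hdy
    have hyv : y ≠ v := by rintro rfl; rw [hd, hd₁] at hdy; exact hb₁ hdy.symm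
    refine ⟨hyv, ?_⟩
    have hvy : d v y ≠ b := fun heq' =>
      (eq_or_eq_of_mem_privateColors hb hv hy hyv.symm heq').elim hx₁v.symm hyx
    have hy₂ : y ≠ x₂ := by rintro rfl; exact hb₂ hdy.symm
    have hy₃ : y ≠ x₃ := by rintro rfl; exact hb₂ (hdy.symm.trans heq.symm)
    by_contra hne
    have n₂ := hno v x₁ x₂ y
    have n₃ := hno v x₁ x₃ y
    unfold IsProperBook at n₂ n₃
    grind
  have hlt : (S.filter fun x => x ≠ x₁ ∧ d x₁ x = b).card <
      (S.filter fun x => x ≠ v ∧ d v x = c₁).card := by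
    refine Finset.card_lt_card (Finset.ssubset_iff_subset_ne.2 ⟨?_, ?_⟩)
    · intro y hy
      obtain ⟨hyS, hyx, hyb⟩ := Finset.mem_filter.1 hy
      exact Finset.mem_filter.2 ⟨hyS, hclass y hyS hyx hyb⟩
    · intro heq'
      have : x₁ ∈ S.filter fun x => x ≠ v ∧ d v x = c₁ :=
        Finset.mem_filter.2 ⟨hx₁, hx₁v, hd₁⟩
      rw [← heq'] at this
      exact (Finset.mem_filter.1 this).2.1 rfl
  exact absurd (hmin _ (hQ x₁ b hx₁ hb)) (not_le.2 hlt)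

/-- Without a proper book some vertex has at most two private colors; deleting it loses only those.
-/
theorem card_colorsOn_le {d : V → V → ℕ} (hd : ∀ x y, d x y = d y x)
    (hno : ∀ u v x y, ¬ IsProperBook d u v x y) (S : Finset V) :
    (colorsOn d S).card ≤ 2 * S.card := by
  induction S using Finset.strongInduction with
  | H S ih =>
    rcases S.eq_empty_or_nonempty with rfl | hS
    · simp [colorsOn]
    by_cases h : ∀ v ∈ S, 2 < (privateColors d S v).card
    · obtain ⟨u, v, x, y, hB⟩ := exists_isProperBook hd hS h
      exact absurd hB (hno u v x y)
    · push Not at h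
      obtain ⟨v, hv, hcard⟩ := h
      have h1 := ih (S.erase v) (Finset.erase_ssubset hv)
      have h2 : (colorsOn d S).card ≤ (colorsOn d S \ colorsOn d (S.erase v)).card +
          (colorsOn d (S.erase v)).card := by
        have := Finset.le_card_sdiff (colorsOn d (S.erase v)) (colorsOn d S)
        omega
      have h3 := Finset.card_erase_add_one hv
      unfold privateColors at hcard
      omega

end ProperBook

theorem Lr_book_le {t : ℕ} (ht : t = 1 ∨ t = 2) (n : ℕ) : Lr n (book t) ≤ 2 * n + 1 := by
  classical
  refine familyNumber_le fun c hc => ?_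
  -- The value on the diagonal is never used: `colorsOn` and `IsProperBook` involve distinct
  -- vertices only.
  let d : Fin n → Fin n → ℕ := fun x y => if h : x ≠ y then c ⟨s(x, y), h⟩ else 0
  have hdc : ∀ x y (h : x ≠ y), c ⟨s(x, y), h⟩ = d x y := fun x y h => by simp [d, h]
  have hd : ∀ x y, d x y = d y x := by
    intro x y
    by_cases h : x = y
    · rw [h]
    · rw [← hdc x y h, ← hdc y x (Ne.symm h)]
      congr 2
      exact Sym2.eq_swap
  have hex : ∃ u v x y, IsProperBook d u v x y := by
    by_contra! hno
    have h1 := card_colorsOn_le hd hno Finset.univ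
    rw [Finset.card_univ, Fintype.card_fin] at h1
    have h2 : (Set.range c).ncard ≤ (colorsOn d Finset.univ).card := by
      rw [← Set.ncard_coe_finset]
      refine Set.ncard_le_ncard ?_ (Set.toFinite _)
      rintro _ ⟨⟨e, he⟩, rfl⟩
      induction e using Sym2.inductionOn with
      | _ x y => exact mem_colorsOn.2 ⟨x, Finset.mem_univ _, y, Finset.mem_univ _, he, (hdc x y he).symm⟩
    omega
  obtain ⟨u, v, x, y, hB⟩ := hex
  have ht2 : t ≤ 2 := by omega
  -- For `t = 1` the page `y` is dropped.
  let f : Fin 2 ⊕ Fin t → Fin n := Sum.elim ![u, v] fun j => ![x, y] (Fin.castLE ht2 j)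
  have hfl : ∀ i, f (Sum.inl i) = u ∨ f (Sum.inl i) = v := by
    intro i
    fin_cases i <;> simp [f]
  have hfr : ∀ j, f (Sum.inr j) = x ∨ f (Sum.inr j) = y := by
    intro j
    simp only [f, Sum.elim_inr]
    generalize Fin.castLE ht2 j = i
    fin_cases i <;> simp
  have hfa : ∀ a, f a = u ∨ f a = v ∨ f a = x ∨ f a = y := by
    rintro (i | j)
    · exact (hfl i).imp_right Or.inl
    · exact Or.inr (Or.inr (hfr j))
  have hf : Function.Injective f := by
    obtain ⟨huv, hux, huy, hvx, hvy, hxy, -⟩ := hB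
    refine Function.Injective.sumElim ?_ ?_ ?_
    · intro i j h
      fin_cases i <;> fin_cases j <;> simp_all
    · refine Function.Injective.comp ?_ (Fin.castLE_injective ht2)
      intro i j h
      fin_cases i <;> fin_cases j <;> simp_all
    · intro i j
      generalize Fin.castLE ht2 j = k
      fin_cases i <;> fin_cases k <;> simpa
  refine ⟨⟨⟨f, fun h => hf.ne h.ne⟩, hf⟩, ?_⟩
  rw [isFamilyColored_matchings_iff]
  intro a b e hb he heq
  replace heq : d (f a) (f b) = d (f a) (f e) := by
    rw [← hdc _ _ (hf.ne hb.ne), ← hdc _ _ (hf.ne he.ne)]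
    exact heq
  by_contra hne
  rcases a with a | a
  · exact hB.ne_of_spine hd (hfl a) (hfa b) (hfa e) (hf.ne hb.ne) (hf.ne he.ne) (hf.ne hne) heq
  · rcases b with b | b
    · rcases e with e | e
      · exact hB.ne_of_page hd (hfr a) (hfl b) (hfl e) (hf.ne hne) heq
      · exact bookOver_adj_inr _ _ he
    · exact bookOver_adj_inr _ _ hb

/-! ### Assembling the estimates -/

theorem matchings_of_cross {W : Type u} {r : ℕ} (w : W) (j : Fin r) (D : SimpleGraph (W ⊕ Fin r))
    (hD : D ≠ ⊥) (h : ∀ x y, D.Adj x y → s(x, y) = s(Sum.inl w, Sum.inr j)) : matchings _ D := by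
  refine ⟨hD, fun x y z hy hz => ?_⟩
  exact Sym2.congr_right.1 ((h x y hy).trans (h x z hz).symm)

theorem Lr_bookOver_isBigO {W : Type u} [Fintype W] {H : SimpleGraph W} {r : ℕ}
    (hW : 1 ≤ Fintype.card W) (hH : ∀ x y z, H.Adj x y → H.Adj x z → y = z) :
    (fun n : ℕ => (Lr n (bookOver H r) : ℝ)) =O[atTop]
      fun n : ℕ => (n : ℝ) ^ (2 - 1 / (Fintype.card W : ℝ)) := by
  refine familyNumber_bookOver_isBigO_rpow hW matchings_of_cross fun D hD h => ⟨hD, ?_⟩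
  intro x y z hy hz
  obtain ⟨a, b, hab, rfl, rfl⟩ := h x y hy
  obtain ⟨a', b', hab', haa, rfl⟩ := h _ z hz
  obtain rfl := Sum.inl_injective haa
  rw [hH _ _ _ hab hab']

theorem LrDefective_bookOver_isBigO {W : Type u} [Fintype W] {H : SimpleGraph W}
    [DecidableRel H.Adj] {r t : ℕ} (hW : 1 ≤ Fintype.card W) (ht : 1 ≤ t) (hH : H.maxDegree ≤ t) :
    (fun n : ℕ => (LrDefective n t (bookOver H r) : ℝ)) =O[atTop]
      fun n : ℕ => (n : ℝ) ^ (2 - 1 / (Fintype.card W : ℝ)) := by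
  refine familyNumber_bookOver_isBigO_rpow hW
    (fun w j D hD h => degreeAtMost_of_matchings ht (matchings_of_cross w j D hD h))
    fun D hD h x => ?_
  rcases x with x | x
  · have hsub : D.neighborSet (Sum.inl x) ⊆ Sum.inl '' (H.neighborFinset x : Set W) := by
      intro y hy
      obtain ⟨a, b, hab, ha, rfl⟩ := h _ y hy
      obtain rfl := Sum.inl_injective ha
      exact ⟨b, by simpa using hab, rfl⟩
    refine (Set.encard_le_encard hsub).trans ((Set.encard_image_le _ _).trans ?_)
    rw [Set.encard_coe_eq_coe_finsetCard, H.card_neighborFinset_eq_degree]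
    exact_mod_cast (H.degree_le_maxDegree x).trans hH
  · have : D.neighborSet (Sum.inr x) = ∅ := by
      ext y
      simp only [mem_neighborSet, Set.mem_empty_iff_false, iff_false]
      intro hy
      obtain ⟨a, b, -, ha, -⟩ := h _ y hy
      simp at ha
    rw [this]
    simp

theorem Lr_book_isTheta_of_le_two {t : ℕ} (ht : t = 1 ∨ t = 2) :
    (fun n : ℕ => (Lr n (book t) : ℝ)) =Θ[atTop] fun n : ℕ => (n : ℝ) := by
  refine ⟨IsBigO.of_bound 3 ?_, IsBigO.of_bound 1 ?_⟩
  · filter_upwards [eventually_ge_atTop 1] with n hn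
    rw [Real.norm_of_nonneg (by positivity), Real.norm_of_nonneg (by positivity)]
    have h := Lr_book_le ht n
    have : Lr n (book t) ≤ 3 * n := by omega
    exact_mod_cast this
  · refine Eventually.of_forall fun n => ?_
    rw [Real.norm_of_nonneg (by positivity), Real.norm_of_nonneg (by positivity), one_mul]
    exact_mod_cast le_Lr_book (by omega) n

theorem Lr_book_isTheta {t : ℕ} (ht : 3 ≤ t) :
    (fun n : ℕ => (Lr n (book t) : ℝ)) =Θ[atTop] fun n : ℕ => (n : ℝ) ^ (3 / 2 : ℝ) := by
  refine ⟨?_, rpow_isBigO_Lr_book ht⟩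
  have h := Lr_bookOver_isBigO (H := (⊤ : SimpleGraph (Fin 2))) (r := t) (by simp) (by decide)
  rw [Fintype.card_fin] at h
  rw [show (3 / 2 : ℝ) = 2 - 1 / ((2 : ℕ) : ℝ) by norm_num]
  exact h

theorem mainTheorem9 :
    (∀ t : ℕ, t = 1 ∨ t = 2 →
      (fun n : ℕ => (Lr n (book t) : ℝ)) =Θ[atTop] fun n : ℕ => (n : ℝ)) ∧
    (∀ t : ℕ, 3 ≤ t →
      (fun n : ℕ => (Lr n (book t) : ℝ)) =Θ[atTop] fun n : ℕ => (n : ℝ) ^ (3 / 2 : ℝ)) ∧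
    (∀ s : ℕ, 1 ≤ s → ∃ t₀ : ℕ, ∀ t : ℕ, t₀ ≤ t →
      (fun n : ℕ => (Lr n (matchingBook s t) : ℝ)) =Θ[atTop]
        fun n : ℕ => (n : ℝ) ^ (2 - 1 / (2 * (s : ℝ)))) ∧
    (∀ s t : ℕ, 1 ≤ s → 1 ≤ t → ∃ r₀ : ℕ,
      ∀ (W : Type u) [Fintype W] (H : SimpleGraph W) [DecidableRel H.Adj],
        Fintype.card W = s → H.maxDegree ≤ t → ∀ r : ℕ, r₀ ≤ r →
          (fun n : ℕ => (LrDefective n t (bookOver H r) : ℝ)) =Θ[atTop]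
            fun n : ℕ => (n : ℝ) ^ (2 - 1 / (s : ℝ))) := by
  refine ⟨fun t ht => Lr_book_isTheta_of_le_two ht, fun t ht => Lr_book_isTheta ht,
    fun s hs => ?_, fun s t hs ht => ?_⟩
  -- The spine has `2 * s` vertices, and matchings have maximum degree at most 1.
  · obtain ⟨t₀, h⟩ := rpow_isBigO_familyNumber_bookOver.{0} (s := 2 * s) (t := 1) (by omega)
    have hcard : Fintype.card (Fin s × Fin 2) = 2 * s := by simp [mul_comm]
    have hcast : 2 * (s : ℝ) = ((2 * s : ℕ) : ℝ) := by push_cast; rfl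
    refine ⟨t₀, fun t ht => ⟨?_, ?_⟩⟩
    · have hub := Lr_bookOver_isBigO (H := disjointEdges s) (r := t) (by omega) (by
        rintro ⟨x, i⟩ ⟨y, j⟩ ⟨z, k⟩ ⟨hxy, hij⟩ ⟨hxz, hik⟩
        dsimp only at hxy hij hxz hik
        subst hxy hxz
        have : j = k := by omega
        rw [this])
      rwa [hcard, ← hcast] at hub
    · rw [hcast]
      exact h _ (disjointEdges s) matchings hcard
        (fun _ _ hG => degreeAtMost_of_matchings le_rfl hG) t ht
  · obtain ⟨r₀, h⟩ := rpow_isBigO_familyNumber_bookOver.{u} (s := s) (t := t) hs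
    refine ⟨r₀, fun W _ H _ hW hH r hr => ⟨?_, ?_⟩⟩
    · subst hW
      exact LrDefective_bookOver_isBigO hs ht hH
    · exact h W H (degreeAtMost t) hW (fun _ _ hG => hG) r hr
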